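/- Let $K$ be a finite subset of the closed unit disc of $\mathbb C$, let $\mathbb N=\{1,2,\dots\}$, and give $K^{\mathbb N}$ the product topology and the shift $(Sx)_n=x_{n+1}$. For $x,y\in K^{\mathbb N}$ and $n\ge 1$ put $$\mathrm{corr}_n(x,y)=\frac1n\sum_{i=1}^n x_i\overline{y_i}-\Bigl(\frac1n\sum_{i=1}^n x_i\Bigr)\Bigl(\frac1n\sum_{i=1}^n\overline{y_i}\Bigr).$$ Call $x,y$ weakly correlated if $\limsup_n|\mathrm{corr}_n(x,y)|>0$, and strongly correlated if $\liminf_n|\mathrm{corr}_n(x,y)|>0$. A continuous map $T:X\to X$ of a compact metric space is strictly ergodic if it is minimal (every forward orbit is dense) and has exactly one invariant Borel probability measure. A point $y\in K^{\mathbb N}$ is strictly ergodic if there are a strictly ergodic $(X,T)$, a continuous $f:X\to\mathbb C$ and $a\in X$ with $y_n=f(T^na)$ for all $n\ge1$. A point $y\in K^{\mathbb N}$ is generic for a shift-invariant Borel probability measure $\nu$ on $K^{\mathbb N}$ if $\lim_n\frac1n\sum_{i=1}^n f(S^iy)=\int f\,d\nu$ for every continuous $f:K^{\mathbb N}\to\mathbb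 C$. **Theorem.** Let $x\in K^{\mathbb N}$. 1. $x$ is weakly correlated to some strictly ergodic point of $K^{\mathbb N}$ if and only if $x$ is weakly correlated to some point of $K^{\mathbb N}$ that is generic for an ergodic shift-invariant Borel probability measure on $K^{\mathbb N}$. 2. $x$ is strongly correlated to some strictly ergodic point of $K^{\mathbb N}$ if and only if $x$ is strongly correlated to some point of $K^{\mathbb N}$ that is generic for an ergodic shift-invariant Borel probability measure on $K^{\mathbb N}$. -/

import Mathlib

open Filter MeasureTheory Topology

namespace SeqCorr

noncomputable section

/-- The correlation of the initial blocks of length `n` of two complex sequences. Sequences are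
indexed by `ℕ`, the entry with index `i` being the `(i+1)`-st term `x_{i+1}`. -/
def corr (x y : ℕ → ℂ) (n : ℕ) : ℂ :=
  (1 / (n : ℂ)) * ∑ i ∈ Finset.range n, x i * (starRingEnd ℂ) (y i)
    - ((1 / (n : ℂ)) * ∑ i ∈ Finset.range n, x i)
      * ((1 / (n : ℂ)) * ∑ i ∈ Finset.range n, (starRingEnd ℂ) (y i))

/-- Weak correlation (of bounded sequences): the limit superior is positive. -/
def WeaklyCorrelated (x y : ℕ → ℂ) : Prop :=
  0 < limsup (fun n => ‖corr x y n‖) atTop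

/-- Strong correlation (of bounded sequences): the limit inferior is positive. -/
def StronglyCorrelated (x y : ℕ → ℂ) : Prop :=
  0 < liminf (fun n => ‖corr x y n‖) atTop

/-- Minimality of a dynamical system: every forward orbit is dense. -/
def IsMinimal {X : Type*} [TopologicalSpace X] (T : X → X) : Prop :=
  ∀ x : X, Dense (Set.range fun n : ℕ => T^[n] x)

/-- Unique ergodicity: there is exactly one invariant probability measure. -/
def IsUniquelyErgodic {X : Type*} [MeasurableSpace X] (T : X → X) : Prop :=
  ∃! μ : Measure X, IsProbabilityMeasure μ ∧ MeasurePreserving T μ μ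

/-- Strict ergodicity of a dynamical system: minimality and unique ergodicity. -/
def IsStrictlyErgodic {X : Type*} [TopologicalSpace X] [MeasurableSpace X] (T : X → X) : Prop :=
  IsMinimal T ∧ IsUniquelyErgodic T

/-- A complex sequence is strictly ergodic if it has the form `x_n = f (T^n a)`, `n ≥ 1`, with `f` a
continuous function on a strictly ergodic system `(X, T)`, where `X` is compact metric and
`T` is continuous. (A compact metric space has at most continuum many points, so that `X : Type`
is no restriction.) -/
def IsStrictlyErgodicSeq (x : ℕ → ℂ) : Prop :=
  ∃ (X : Type) (_ : MetricSpace X) (_ : CompactSpace X) (_ : MeasurableSpace X) (_ : BorelSpace X)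
    (T : X → X) (f : X → ℂ) (a : X),
    Continuous T ∧ IsStrictlyErgodic T ∧ Continuous f ∧ ∀ n : ℕ, x n = f (T^[n + 1] a)

/-- The point `x` is generic for the (invariant probability) measure `μ`: the ergodic averages
`(1/n) ∑_{i=1}^n f (T^i x)` of every continuous function converge to its integral. -/
def IsGeneric {X : Type*} [TopologicalSpace X] [MeasurableSpace X]
    (T : X → X) (μ : Measure X) (x : X) : Prop :=
  ∀ f : X → ℂ, Continuous f →
    Tendsto (fun n : ℕ => (1 / (n : ℂ)) * ∑ i ∈ Finset.range n, f (T^[i + 1] x)) atTop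
      (𝓝 (∫ z, f z ∂μ))

/-- The shift transformation on one-sided sequences. -/
def shift {A : Type*} (x : ℕ → A) : ℕ → A := fun n => x (n + 1)

/-- The point `y` of the full shift over the finite alphabet `K` is generic for some ergodic
shift-invariant Borel probability measure. -/
def IsGenericForErgodic {K : Finset ℂ} (y : ℕ → K) : Prop :=
  ∃ ν : Measure (ℕ → K), IsProbabilityMeasure ν ∧ Ergodic shift ν ∧ IsGeneric shift ν y

end

end SeqCorr

/-!
A sequence `y` over a finite alphabet which is generic for an ergodic measure has mean frequencies
for every set coded by `y` (`ErgSeq`), by the mean ergodic theorem. Adjoin to `y` a sequence of bits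
which is normal relative to `y`. The pair `w` is still ergodic in this sense, and the bits provide
factors of `w` that mark cut points with any prescribed spacing, even if `y` itself is periodic.

Now cut `y` between sparse marked points into long blocks. By ergodicity of `w` most blocks have
nearly the same word frequencies, and the others are replaced by the nearest typical words of the
same length, which also contain a long initial word of `y`. The new sequence is again a factor of
`w`, so that the step can be iterated with summable changes. The limit `z` differs from `y` on a set
of density at most `ε`, and in `z` all words have uniform frequencies and all initial words recur
with bounded gaps. Hence the orbit closure of `z` is strictly ergodic, and as correlations with a
bounded sequence are continuous in the density of `{y ≠ z}`, weak and strong correlation pass from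
`y` to `z` if `ε` is small.

Conversely, in a uniquely ergodic system every point is generic for the invariant measure, which is
ergodic: by the Krylov–Bogolyubov argument all limits of empirical measures are invariant.
-/

namespace SeqCorr

open Finset (range)

/-! ### Densities -/

open Classical in
/-- The real-valued indicator of a proposition. -/
noncomputable def ind (P : Prop) : ℝ := if P then 1 else 0

lemma ind_nonneg (P : Prop) : 0 ≤ ind P := by
  unfold ind; split_ifs <;> norm_num

lemma ind_le_one (P : Prop) : ind P ≤ 1 := by
  unfold ind; split_ifs <;> norm_num

lemma ind_of {P : Prop} (h : P) : ind P = 1 := by simp [ind, h]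

lemma ind_of_not {P : Prop} (h : ¬ P) : ind P = 0 := by simp [ind, h]

lemma ind_mono {P Q : Prop} (h : P → Q) : ind P ≤ ind Q := by
  by_cases hP : P
  · rw [ind_of hP, ind_of (h hP)]
  · rw [ind_of_not hP]; exact ind_nonneg _

lemma ind_or_le (P Q : Prop) : ind (P ∨ Q) ≤ ind P + ind Q := by
  by_cases hP : P <;> by_cases hQ : Q <;> simp [ind, hP, hQ]

lemma ind_and (P Q : Prop) : ind (P ∧ Q) = ind P * ind Q := by
  by_cases hP : P <;> by_cases hQ : Q <;> simp [ind, hP, hQ]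

lemma ind_forall {ι : Type*} [Fintype ι] (P : ι → Prop) : ind (∀ t, P t) = ∏ t, ind (P t) := by
  simp only [ind, Fintype.prod_boole]
  congr

lemma ind_exists_mem_le {ι : Type*} (s : Finset ι) (P : ι → Prop) :
    ind (∃ t ∈ s, P t) ≤ ∑ t ∈ s, ind (P t) := by
  by_cases h : ∃ t ∈ s, P t
  · obtain ⟨t, ht, hPt⟩ := h
    calc ind _ ≤ ind (P t) := by rw [ind_of hPt]; exact ind_le_one _
      _ ≤ _ := Finset.single_le_sum (f := fun t => ind (P t)) (fun _ _ => ind_nonneg _) ht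
  · rw [ind_of_not h]
    exact Finset.sum_nonneg fun _ _ => ind_nonneg _

lemma abs_ind_sub_ind_le (P Q : Prop) : |ind P - ind Q| ≤ ind (P ≠ Q) := by
  by_cases hP : P <;> by_cases hQ : Q <;> simp [ind, hP, hQ]

lemma eventually_const_le {ε : ℝ} (hε : 0 < ε) (C : ℝ) : ∀ᶠ n : ℕ in atTop, C ≤ ε * n :=
  (tendsto_natCast_atTop_atTop.const_mul_atTop hε).eventually_ge_atTop C

/-- The averages of `h` over long initial segments are at most `η`. -/
def UpperMeanLE (h : ℕ → ℝ) (η : ℝ) : Prop :=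
  ∀ᶠ n : ℕ in atTop, ∑ i ∈ range n, h i ≤ η * n

namespace UpperMeanLE

variable {f g : ℕ → ℝ} {η θ : ℝ}

lemma mono (hg : UpperMeanLE g θ) (hfg : ∀ i, f i ≤ g i) (hθ : θ ≤ η) : UpperMeanLE f η := by
  filter_upwards [hg] with n hn
  calc _ ≤ ∑ i ∈ range n, g i := Finset.sum_le_sum fun i _ => hfg i
    _ ≤ θ * n := hn
    _ ≤ η * n := by gcongr

lemma add (hf : UpperMeanLE f η) (hg : UpperMeanLE g θ) :
    UpperMeanLE (fun i => f i + g i) (η + θ) := by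
  filter_upwards [hf, hg] with n hfn hgn
  rw [Finset.sum_add_distrib, add_mul]
  exact add_le_add hfn hgn

lemma const_mul (hf : UpperMeanLE f η) {a : ℝ} (ha : 0 ≤ a) :
    UpperMeanLE (fun i => a * f i) (a * η) := by
  filter_upwards [hf] with n hn
  rw [← Finset.mul_sum, mul_assoc]
  exact mul_le_mul_of_nonneg_left hn ha

lemma const (a : ℝ) : UpperMeanLE (fun _ => a) a :=
  .of_forall fun n => by simp [mul_comm]

lemma le_of_const {a : ℝ} (h : UpperMeanLE (fun _ => a) η) : a ≤ η := by
  obtain ⟨n, hn, hn0⟩ := (h.and (eventually_gt_atTop 0)).exists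
  have hn0' : (0 : ℝ) < n := by exact_mod_cast hn0
  rw [Finset.sum_const, Finset.card_range, nsmul_eq_mul, mul_comm] at hn
  exact le_of_mul_le_mul_right hn hn0'

lemma sum {ι : Type*} (s : Finset ι) {f : ι → ℕ → ℝ} {η : ι → ℝ}
    (hf : ∀ a ∈ s, UpperMeanLE (f a) (η a)) :
    UpperMeanLE (fun i => ∑ a ∈ s, f a i) (∑ a ∈ s, η a) := by
  filter_upwards [(Filter.eventually_all_finset s).2 hf] with n hn
  rw [Finset.sum_comm, Finset.sum_mul]
  exact Finset.sum_le_sum hn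

lemma of_shift {k : ℕ} (hf : UpperMeanLE (fun i => f (k + i)) θ) (hθ : θ < η) :
    UpperMeanLE f η := by
  have hlim : Tendsto (fun n => n - k) atTop atTop := tendsto_sub_atTop_nat k
  filter_upwards [hlim.eventually hf, eventually_ge_atTop k,
    eventually_const_le (sub_pos.2 hθ) (∑ i ∈ range k, f i - θ * k)] with n hn hkn hconst
  obtain ⟨m, rfl⟩ := Nat.exists_eq_add_of_le hkn
  rw [Nat.add_sub_cancel_left] at hn
  rw [Finset.sum_range_add]
  push_cast at hconst ⊢
  linarith

lemma eventually_sum_add_le (hf : UpperMeanLE f θ) (hθ : θ < η) (N : ℕ) :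
    ∀ᶠ n : ℕ in atTop, ∑ i ∈ range (n + N), f i ≤ η * n := by
  filter_upwards [(tendsto_add_atTop_nat N).eventually hf,
    eventually_const_le (sub_pos.2 hθ) (θ * N)] with n hn hconst
  push_cast at hn
  linarith

lemma shift (hf : UpperMeanLE f θ) (hθ : θ < η) (k : ℕ) : UpperMeanLE (fun i => f (k + i)) η := by
  filter_upwards [(tendsto_add_atTop_nat k).eventually hf,
    eventually_const_le (sub_pos.2 hθ) (θ * k - ∑ i ∈ range k, f i)] with n hn hconst
  rw [add_comm n k, Finset.sum_range_add] at hn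
  push_cast at hn
  linarith

end UpperMeanLE

/-- The average of `g` over the window of length `N` starting at `i`. -/
noncomputable def windowMean (g : ℕ → ℝ) (N i : ℕ) : ℝ := (∑ j ∈ range N, g (i + j)) / N

lemma windowMean_add (f g : ℕ → ℝ) (N i : ℕ) :
    windowMean (fun i => f i + g i) N i = windowMean f N i + windowMean g N i := by
  simp [windowMean, Finset.sum_add_distrib, add_div]

lemma windowMean_const_mul (a : ℝ) (f : ℕ → ℝ) (N i : ℕ) :
    windowMean (fun i => a * f i) N i = a * windowMean f N i := by
  simp [windowMean, ← Finset.mul_sum, mul_div_assoc]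

lemma abs_windowMean_sub_windowMean_le (f g : ℕ → ℝ) (N i : ℕ) :
    |windowMean f N i - windowMean g N i| ≤ windowMean (fun i => |f i - g i|) N i := by
  simp only [windowMean, ← sub_div, ← Finset.sum_sub_distrib, abs_div, Nat.abs_cast]
  gcongr
  exact Finset.abs_sum_le_sum_abs _ _

lemma sum_range_shift_le {h : ℕ → ℝ} (h0 : ∀ i, 0 ≤ h i) {n j m : ℕ} (hm : n + j ≤ m) :
    ∑ i ∈ range n, h (i + j) ≤ ∑ i ∈ range m, h i := by
  calc ∑ i ∈ range n, h (i + j) ≤ ∑ i ∈ range (j + n), h i := by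
        rw [Finset.sum_range_add]
        simpa only [add_comm j] using le_add_of_nonneg_left (Finset.sum_nonneg fun i _ => h0 i)
    _ ≤ ∑ i ∈ range m, h i := Finset.sum_le_sum_of_subset_of_nonneg
        (Finset.range_subset_range.2 (by omega)) fun i _ _ => h0 i

lemma sum_windowMean_le {h : ℕ → ℝ} (h0 : ∀ i, 0 ≤ h i) (N n : ℕ) :
    ∑ i ∈ range n, windowMean h N i ≤ ∑ i ∈ range (n + N), h i := by
  have hpos : 0 ≤ ∑ i ∈ range (n + N), h i := Finset.sum_nonneg fun i _ => h0 i
  rcases Nat.eq_zero_or_pos N with rfl | hN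
  · simpa [windowMean] using hpos
  have hshift : ∀ j ∈ range N, ∑ i ∈ range n, h (i + j) ≤ ∑ i ∈ range (n + N), h i := fun _ hj =>
    sum_range_shift_le h0 (by gcongr; exact (Finset.mem_range.1 hj).le)
  unfold windowMean
  rw [← Finset.sum_div, Finset.sum_comm, div_le_iff₀ (by positivity)]
  calc _ ≤ ∑ _j ∈ range N, ∑ i ∈ range (n + N), h i := Finset.sum_le_sum hshift
    _ = _ := by simp [mul_comm]

lemma UpperMeanLE.windowMean {h : ℕ → ℝ} {η θ : ℝ} (hh : UpperMeanLE h θ) (h0 : ∀ i, 0 ≤ h i)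
    (hθ : θ < η) (N : ℕ) : UpperMeanLE (windowMean h N) η :=
  (hh.eventually_sum_add_le hθ N).mono fun n hn => (sum_windowMean_le h0 N n).trans hn

/-- The averages of `g` over most long windows are close to `c`. -/
def HasMean (g : ℕ → ℝ) (c : ℝ) : Prop :=
  ∀ ε > 0, ∀ᶠ N in atTop, UpperMeanLE (fun i => |windowMean g N i - c|) ε

namespace HasMean

variable {f g : ℕ → ℝ} {c d η : ℝ}

lemma add (hf : HasMean f c) (hg : HasMean g d) : HasMean (fun i => f i + g i) (c + d) := by
  intro ε hε
  filter_upwards [hf (ε / 2) (half_pos hε), hg (ε / 2) (half_pos hε)] with N hfN hgN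
  refine (hfN.add hgN).mono (fun i => ?_) (add_halves ε).le
  rw [windowMean_add, add_sub_add_comm]
  exact abs_add_le _ _

lemma const_mul (hf : HasMean f c) (a : ℝ) : HasMean (fun i => a * f i) (a * c) := by
  intro ε hε
  filter_upwards [hf (ε / (|a| + 1)) (by positivity)] with N hfN
  refine (hfN.const_mul (abs_nonneg a)).mono (fun i => ?_) ?_
  · rw [windowMean_const_mul, ← mul_sub, abs_mul]
  · calc |a| * (ε / (|a| + 1)) ≤ (|a| + 1) * (ε / (|a| + 1)) := by gcongr; linarith
      _ = ε := by field_simp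

lemma const (a : ℝ) : HasMean (fun _ => a) a := by
  intro ε hε
  filter_upwards [eventually_ne_atTop 0] with N hN
  exact (UpperMeanLE.const 0).mono (fun i => by simp [windowMean, hN]) hε.le

lemma sum {ι : Type*} (s : Finset ι) {f : ι → ℕ → ℝ} {c : ι → ℝ}
    (hf : ∀ a ∈ s, HasMean (f a) (c a)) : HasMean (fun i => ∑ a ∈ s, f a i) (∑ a ∈ s, c a) := by
  classical
  induction s using Finset.induction_on with
  | empty => simpa using const 0
  | insert a s ha ih =>
    simp only [Finset.sum_insert ha]
    exact (hf a (by simp)).add (ih fun b hb => hf b (by simp [hb]))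

lemma of_shift {k : ℕ} (h : HasMean (fun i => g (k + i)) c) : HasMean g c := by
  intro ε hε
  filter_upwards [h (ε / 2) (half_pos hε)] with N hN
  refine UpperMeanLE.of_shift (k := k) (hN.mono (fun i => ?_) le_rfl) (half_lt_self hε)
  simp only [windowMean, add_assoc, le_refl]

lemma of_close (hg : HasMean g d) (hfg : UpperMeanLE (fun i => |f i - g i|) η) {ε : ℝ}
    (hε : η + |d - c| < ε) : ∀ᶠ N in atTop, UpperMeanLE (fun i => |windowMean f N i - c|) ε := by
  set ρ := ε - (η + |d - c|)
  have hρ : 0 < ρ := sub_pos.2 hε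
  filter_upwards [hg (ρ / 2) (half_pos hρ)] with N hN
  have hclose := hfg.windowMean (fun i => abs_nonneg _) (by linarith : η < η + ρ / 2) N
  refine ((hclose.add hN).add (.const |d - c|)).mono (fun i => ?_) (by simp only [ρ]; linarith)
  calc |windowMean f N i - c|
      ≤ |windowMean f N i - windowMean g N i| + |windowMean g N i - d| + |d - c| :=
        (abs_sub_le _ d _).trans (by gcongr; exact abs_sub_le _ _ _)
    _ ≤ _ := by gcongr; exact abs_windowMean_sub_windowMean_le f g N i

lemma abs_sub_le (hf : HasMean f c) (hg : HasMean g d)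
    (hfg : UpperMeanLE (fun i => |f i - g i|) η) : |c - d| ≤ η := by
  refine le_of_forall_pos_le_add fun ε hε => ?_
  obtain ⟨N, hfc, hfd⟩ := ((hf (ε / 2) (half_pos hε)).and
    (hg.of_close (c := d) hfg (by simpa using hε : η + |d - d| < η + ε / 2))).exists
  refine ((hfc.add hfd).mono (f := fun _ => |c - d|) (fun i => ?_) ?_).le_of_const
  · rw [abs_sub_comm (windowMean f N i) c]
    exact _root_.abs_sub_le _ _ _
  · linarith

/-- The means of ever better approximations form a Cauchy sequence. -/
lemma exists_of_approx
    (h : ∀ η > 0, ∃ g, (∃ d, HasMean g d) ∧ UpperMeanLE (fun i => |f i - g i|) η) :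
    ∃ c, HasMean f c := by
  choose g hg hfg using fun k : ℕ => h (1 / ((k : ℝ) + 1)) Nat.one_div_pos_of_nat
  choose d hd using hg
  have hlim : Tendsto (fun k : ℕ => 1 / ((k : ℝ) + 1)) atTop (𝓝 0) :=
    tendsto_one_div_add_atTop_nhds_zero_nat
  have hdist : ∀ k l, |d k - d l| ≤ 1 / ((k : ℝ) + 1) + 1 / ((l : ℝ) + 1) := fun k l => by
    refine (hd k).abs_sub_le (hd l) (((hfg k).add (hfg l)).mono (fun i => ?_) le_rfl)
    rw [abs_sub_comm (f i) (g k i)]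
    exact _root_.abs_sub_le _ _ _
  have hcauchy : CauchySeq d := by
    refine Metric.cauchySeq_iff'.2 fun ε hε => ?_
    obtain ⟨K, hK⟩ := eventually_atTop.1 (hlim.eventually_lt_const (half_pos hε))
    exact ⟨K, fun k hk => (hdist k K).trans_lt (by linarith [hK k hk, hK K le_rfl])⟩
  obtain ⟨c, hc⟩ := cauchySeq_tendsto_of_complete hcauchy
  refine ⟨c, fun ε hε => ?_⟩
  have htotal : Tendsto (fun k : ℕ => 1 / ((k : ℝ) + 1) + |d k - c|) atTop (𝓝 0) := by
    simpa using hlim.add (hc.sub_const c).abs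
  obtain ⟨k, hk⟩ := (htotal.eventually_lt_const hε).exists
  exact (hd k).of_close (hfg k) hk

end HasMean

/-! ### Local codes and factors -/

/-- `v` is given by a two-sided block code of radius `D` applied to `w`. The first `D` entries
of `v`, where the window would reach beyond the origin, are unrestricted. -/
def LocalTo {B C : Type*} (v : ℕ → B) (w : ℕ → C) : Prop :=
  ∃ D : ℕ, ∀ i j, (∀ t ≤ 2 * D, w (i + t) = w (j + t)) → v (D + i) = v (D + j)

/-- `v` is a factor of `w` in the sense of ergodic theory: block codes applied to `w` agree
with `v` outside sets of arbitrarily small density. -/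
def FactorOf {B C : Type*} (v : ℕ → B) (w : ℕ → C) : Prop :=
  ∀ η > 0, ∃ v' : ℕ → B, LocalTo v' w ∧ UpperMeanLE (fun i => ind (v i ≠ v' i)) η

/-- The sequence counterpart of ergodicity: every set coded by `w` has nearly the same frequency
in most long windows. -/
def ErgSeq {B : Type*} (w : ℕ → B) : Prop :=
  ∀ v : ℕ → Prop, LocalTo v w → ∃ c, HasMean (fun i => ind (v i)) c

variable {A B C : Type*}

namespace LocalTo

lemma exists_radius {v : ℕ → B} {w : ℕ → C} (h : LocalTo v w) : ∃ D₀ : ℕ, ∀ D, D₀ ≤ D →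
    ∀ i j, (∀ t ≤ 2 * D, w (i + t) = w (j + t)) → v (D + i) = v (D + j) := by
  obtain ⟨D₀, h⟩ := h
  refine ⟨D₀, fun D hD i j hw => ?_⟩
  obtain ⟨k, rfl⟩ := Nat.exists_eq_add_of_le hD
  simpa only [add_assoc] using
    h (k + i) (k + j) fun t ht => by simpa [add_assoc, add_left_comm] using hw (k + t) (by omega)

lemma refl (v : ℕ → B) : LocalTo v v :=
  ⟨0, fun i j h => by simpa using h 0 le_rfl⟩

lemma trans {u : ℕ → A} {v : ℕ → B} {w : ℕ → C} (huv : LocalTo u v) (hvw : LocalTo v w) :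
    LocalTo u w := by
  obtain ⟨D, hD⟩ := huv
  obtain ⟨E, hE⟩ := hvw
  refine ⟨D + E, fun i j hw => ?_⟩
  rw [add_assoc, add_assoc]
  refine hD _ _ fun t ht => ?_
  rw [add_assoc, add_assoc]
  refine hE _ _ fun s hs => ?_
  simpa only [add_assoc] using hw (t + s) (by omega)

lemma comp {v : ℕ → B} {w : ℕ → C} (h : LocalTo v w) (f : B → A) :
    LocalTo (fun i => f (v i)) w := by
  obtain ⟨D, hD⟩ := h
  exact ⟨D, fun i j hw => congrArg f (hD i j hw)⟩

lemma prodMk {u : ℕ → A} {v : ℕ → B} {w : ℕ → C} (hu : LocalTo u w) (hv : LocalTo v w) :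
    LocalTo (fun i => (u i, v i)) w := by
  obtain ⟨D, hD⟩ := hu.exists_radius
  obtain ⟨E, hE⟩ := hv.exists_radius
  exact ⟨max D E, fun i j hw =>
    Prod.ext (hD _ (le_max_left D E) i j hw) (hE _ (le_max_right D E) i j hw)⟩

/-- A block code can be applied to every sequence. -/
lemma transfer {u : ℕ → A} {v : ℕ → B} (h : LocalTo u v) : ∃ D : ℕ, ∀ v' : ℕ → B,
    ∃ u' : ℕ → A, LocalTo u' v' ∧
      ∀ i, (∀ t ≤ 2 * D, v (i + t) = v' (i + t)) → u (D + i) = u' (D + i) := by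
  classical
  obtain ⟨D, hD⟩ := h
  let code : (ℕ → B) → A := fun W =>
    if h : ∃ j, ∀ t ≤ 2 * D, v (j + t) = W t then u (D + h.choose) else u 0
  refine ⟨D, fun v' => ⟨fun k => code fun t => v' (k - D + min t (2 * D)), ?_, fun i hi => ?_⟩⟩
  · refine ⟨D, fun i j hw => congrArg code (funext fun t => ?_)⟩
    simpa only [Nat.add_sub_cancel_left] using hw _ (min_le_right t (2 * D))
  · have hex : ∃ j, ∀ t ≤ 2 * D, v (j + t) = v' (D + i - D + min t (2 * D)) :=
      ⟨i, fun t ht => by rw [Nat.add_sub_cancel_left, min_eq_left ht, hi t ht]⟩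
    simp only [code]
    rw [dif_pos hex]
    refine hD _ _ fun t ht => ?_
    rw [hex.choose_spec t ht, Nat.add_sub_cancel_left, min_eq_left ht, hi t ht]

lemma factorOf {u : ℕ → A} {v : ℕ → B} (h : LocalTo u v) : FactorOf u v := fun _ hη =>
  ⟨u, h, (UpperMeanLE.const 0).mono (fun _ => (ind_of_not (not_not.2 rfl)).le) hη.le⟩

end LocalTo

lemma ind_ne_le_ind_ne_add_ind_ne (a b c : A) : ind (a ≠ c) ≤ ind (a ≠ b) + ind (b ≠ c) :=
  (ind_mono fun hac => not_and_or.1 fun h => hac (h.1.trans h.2)).trans (ind_or_le _ _)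

namespace FactorOf

lemma of_approx {u : ℕ → A} {w : ℕ → C}
    (h : ∀ η > 0, ∃ u', FactorOf u' w ∧ UpperMeanLE (fun i => ind (u i ≠ u' i)) η) :
    FactorOf u w := by
  intro η hη
  obtain ⟨u', hu', huu'⟩ := h (η / 2) (half_pos hη)
  obtain ⟨u'', hu'', hu'u''⟩ := hu' (η / 2) (half_pos hη)
  exact ⟨u'', hu'', (huu'.add hu'u'').mono
    (fun i => ind_ne_le_ind_ne_add_ind_ne _ _ _) (add_halves η).le⟩

lemma congr {u u' : ℕ → A} {w : ℕ → C} (h : FactorOf u w) {D : ℕ}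
    (heq : ∀ i, u' (D + i) = u (D + i)) : FactorOf u' w :=
  .of_approx fun _ hη => ⟨u, h, .of_shift (k := D) ((UpperMeanLE.const 0).mono
    (fun i => (ind_of_not (not_not.2 (heq i))).le) le_rfl) hη⟩

lemma prodMk {u : ℕ → A} {v : ℕ → B} {w : ℕ → C} (hu : FactorOf u w) (hv : FactorOf v w) :
    FactorOf (fun i => (u i, v i)) w := by
  intro η hη
  obtain ⟨u', hu', huu'⟩ := hu (η / 2) (half_pos hη)
  obtain ⟨v', hv', hvv'⟩ := hv (η / 2) (half_pos hη)
  refine ⟨_, hu'.prodMk hv', (huu'.add hvv').mono (fun i => ?_) (add_halves η).le⟩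
  exact (ind_mono fun hne => not_and_or.1 fun h => hne (Prod.ext h.1 h.2)).trans (ind_or_le _ _)

lemma hasMean {v : ℕ → Prop} {w : ℕ → C} (h : FactorOf v w) (hw : ErgSeq w) :
    ∃ c, HasMean (fun i => ind (v i)) c :=
  HasMean.exists_of_approx fun η hη => by
    obtain ⟨v', hv', hvv'⟩ := h η hη
    exact ⟨_, hw v' hv', hvv'.mono (fun i => abs_ind_sub_ind_le _ _) le_rfl⟩

end FactorOf

lemma UpperMeanLE.exists_window {P : ℕ → Prop} {θ η : ℝ} (h : UpperMeanLE (fun i => ind (P i)) θ)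
    (hθ : θ < η) (N : ℕ) : UpperMeanLE (fun i => ind (∃ t ∈ range N, P (i + t))) (N * η) := by
  refine (UpperMeanLE.sum (range N) (η := fun _ => η) fun t _ =>
    h.shift hθ t).mono (fun i => ?_) (by simp)
  simpa only [add_comm] using ind_exists_mem_le (range N) fun t => P (i + t)

lemma LocalTo.factorOf_trans {u : ℕ → A} {v : ℕ → B} {w : ℕ → C} (h : LocalTo u v)
    (hv : FactorOf v w) : FactorOf u w := by
  intro η hη
  obtain ⟨D, hD⟩ := h.transfer
  obtain ⟨v', hv', hvv'⟩ := hv (η / (4 * (2 * D + 1))) (by positivity)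
  obtain ⟨u', hu', huu'⟩ := hD v'
  refine ⟨u', hu'.trans hv', .of_shift (k := D) ?_ (half_lt_self hη)⟩
  have hθ : η / (4 * (2 * D + 1)) < η / (2 * (2 * D + 1)) := by gcongr; norm_num
  refine (hvv'.exists_window hθ (2 * D + 1)).mono (fun i => ind_mono fun hne => ?_) ?_
  · by_contra! hagree
    exact hne (huu' i fun t ht => hagree t (Finset.mem_range.2 (by omega)))
  · push_cast
    exact le_of_eq (by field_simp)

/-! ### Relatively normal bits -/

/-- The sign attached to a bit. -/
def sign (b : Bool) : ℝ := if b then 1 else -1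

lemma sign_sq (b : Bool) : sign b ^ 2 = 1 := by cases b <;> norm_num [sign]

lemma abs_sign (b : Bool) : |sign b| = 1 := by cases b <;> norm_num [sign]

lemma abs_prod_sign {ι : Type*} (s : Finset ι) (b : ι → Bool) : |∏ t ∈ s, sign (b t)| = 1 := by
  rw [Finset.abs_prod, Finset.prod_eq_one fun t _ => abs_sign (b t)]

lemma ind_bool_eq (b c : Bool) : ind (b = c) = (1 + sign c * sign b) / 2 := by
  cases b <;> cases c <;> norm_num [ind, sign]

lemma exists_sign_mul_nonpos (x : ℝ) : ∃ s, sign s * x ≤ 0 := by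
  rcases le_total x 0 with h | h
  · exact ⟨true, by simpa [sign] using h⟩
  · exact ⟨false, by simpa [sign] using h⟩

lemma exists_sign_tsum_sq_add_le {ι : Type*} {w S H : ι → ℝ} {c : ℝ} (hw : ∀ a, 0 ≤ w a)
    (hsum : Summable w) (hS : ∀ a, |S a| ≤ c) (hH : ∀ a, |H a| ≤ 1) :
    ∃ s, ∑' a, w a * (S a + sign s * H a) ^ 2 ≤ ∑' a, w a * S a ^ 2 + ∑' a, w a := by
  have summable_mul : ∀ (f : ι → ℝ) (d : ℝ), (∀ a, |f a| ≤ d) → Summable fun a => w a * f a :=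
    fun f d hf => .of_norm_bounded (hsum.mul_right d) fun a => by
      rw [Real.norm_eq_abs, abs_mul, abs_of_nonneg (hw a)]
      exact mul_le_mul_of_nonneg_left (hf a) (hw a)
  have hS2 := summable_mul (fun a => S a ^ 2) (c ^ 2) fun a => by
    rw [abs_pow]; exact pow_le_pow_left₀ (abs_nonneg _) (hS a) 2
  have hH2 := summable_mul (fun a => H a ^ 2) 1 fun a => by
    rw [abs_pow]; exact pow_le_one₀ (abs_nonneg _) (hH a)
  have hSH := summable_mul (fun a => S a * H a) c fun a => by
    rw [abs_mul]; exact (mul_le_of_le_one_right (abs_nonneg _) (hH a)).trans (hS a)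
  obtain ⟨s, hs⟩ := exists_sign_mul_nonpos (∑' a, w a * (S a * H a))
  refine ⟨s, ?_⟩
  calc ∑' a, w a * (S a + sign s * H a) ^ 2
      = ∑' a, (w a * S a ^ 2 + 2 * sign s * (w a * (S a * H a)) + w a * H a ^ 2) :=
        tsum_congr fun a => by linear_combination w a * H a ^ 2 * sign_sq s
    _ = ∑' a, w a * S a ^ 2 + 2 * (sign s * ∑' a, w a * (S a * H a)) + ∑' a, w a * H a ^ 2 := by
        rw [(hS2.add (hSH.mul_left _)).tsum_add hH2, hS2.tsum_add (hSH.mul_left _),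
          tsum_mul_left, mul_assoc]
    _ ≤ ∑' a, w a * S a ^ 2 + 2 * 0 + ∑' a, w a := by
        gcongr with a
        exact mul_le_of_le_one_right (hw a) ((sq_le_one_iff_abs_le_one _).2 (hH a))
    _ = _ := by ring

lemma exists_forall_of_prefix_extends {P : ℕ → (ℕ → A) → Prop} {r₀ : ℕ → A} (h0 : P 0 r₀)
    (hcongr : ∀ n r r', (∀ i < n, r i = r' i) → P n r → P n r')
    (hextend : ∀ n r, P n r → ∃ r', P (n + 1) r' ∧ ∀ i < n, r' i = r i) :
    ∃ r, ∀ n, P n r := by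
  choose! next hnext hagree using hextend
  let ρ : ℕ → ℕ → A := fun n => n.rec r₀ next
  have hρ : ∀ n, P n (ρ n) := fun n => by
    induction n with
    | zero => exact h0
    | succ n ih => exact hnext n _ ih
  have hstable : ∀ i d, ρ (i + 1 + d) i = ρ (i + 1) i := fun i d => by
    induction d with
    | zero => rfl
    | succ d ih => rw [← ih]; exact hagree _ _ (hρ _) i (show i < i + 1 + d by omega)
  refine ⟨fun i => ρ (i + 1) i, fun n => hcongr n (ρ n) _ (fun i hi => ?_) (hρ n)⟩
  obtain ⟨d, rfl⟩ := Nat.exists_eq_add_of_le (Nat.succ_le_of_lt hi)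
  exact hstable i d

/-- Each sign is chosen so as to keep down a weighted sum of the squares of all partial sums. -/
lemma exists_bits_sq_sum_le {ι : Type*} [Countable ι] (H : ι → ℕ → (ℕ → Bool) → ℝ)
    (hH : ∀ a n b, |H a n b| ≤ 1)
    (hpast : ∀ a n b b', (∀ i < n, b i = b' i) → H a n b = H a n b') :
    ∃ b : ℕ → Bool, ∀ a, ∃ c : ℝ, ∀ M : ℕ, (∑ n ∈ range M, sign (b n) * H a n b) ^ 2 ≤ c * M := by
  classical
  have := Encodable.ofCountable ι
  obtain ⟨w, hw, W, hwW, hW⟩ := posSumOfEncodable one_pos ι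
  let S : ι → ℕ → (ℕ → Bool) → ℝ := fun a M b => ∑ n ∈ range M, sign (b n) * H a n b
  have hSpast : ∀ a M b b', (∀ i < M, b i = b' i) → S a M b = S a M b' := fun a M b b' h =>
    Finset.sum_congr rfl fun n hn => by
      have hn := Finset.mem_range.1 hn
      rw [h n hn, hpast a n b b' fun i hi => h i (hi.trans hn)]
  have hS : ∀ a M b, |S a M b| ≤ M := fun a M b => by
    refine (Finset.abs_sum_le_sum_abs _ _).trans ((Finset.sum_le_card_nsmul _ _ 1 ?_).trans ?_)
    · exact fun n _ => by rw [abs_mul, abs_sign, one_mul]; exact hH a n b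
    · simp
  obtain ⟨b, hb⟩ := exists_forall_of_prefix_extends (r₀ := fun _ => true)
    (P := fun M b => ∑' a, w a * S a M b ^ 2 ≤ M) (by simp [S])
    (fun M b b' h hM => by simpa only [hSpast _ M b b' h] using hM) fun M b hM => by
      obtain ⟨s, hs⟩ := exists_sign_tsum_sq_add_le (fun a => (hw a).le) hwW.summable
        (fun a => hS a M b) (fun a => hH a M b)
      have hagree : ∀ i < M, Function.update b M s i = b i := fun i hi =>
        Function.update_of_ne hi.ne _ _
      refine ⟨Function.update b M s, ?_, hagree⟩
      have hsucc : ∀ a, S a (M + 1) (Function.update b M s) = S a M b + sign s * H a M b :=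
        fun a => by
          rw [← hSpast a M _ _ hagree, ← hpast a M _ _ hagree]
          simp only [S, Finset.sum_range_succ, Function.update_self]
      rw [hwW.tsum_eq] at hs
      simp only [hsucc]
      push_cast
      linarith
  refine ⟨b, fun a => ⟨(w a)⁻¹, fun M => ?_⟩⟩
  have hsummable : Summable fun a => w a * S a M b ^ 2 :=
    .of_nonneg_of_le (fun a => mul_nonneg (hw a).le (sq_nonneg _))
      (fun a => mul_le_mul_of_nonneg_left
        (sq_le_sq' (abs_le.1 (hS a M b)).1 (abs_le.1 (hS a M b)).2) (hw a).le)
      (hwW.summable.mul_right _)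
  rw [inv_mul_eq_div, le_div_iff₀' (hw a)]
  exact (hsummable.le_tsum a fun a' _ => mul_nonneg (hw a').le (sq_nonneg _)).trans (hb M)

lemma UpperMeanLE.of_sq_sum_le {f : ℕ → ℝ} {c ε : ℝ} (hε : 0 < ε)
    (h : ∀ n : ℕ, (∑ i ∈ range n, f i) ^ 2 ≤ c * n) : UpperMeanLE f ε := by
  filter_upwards [eventually_const_le (sq_pos_of_pos hε) c] with n hn
  refine le_of_sq_le_sq ?_ (by positivity)
  calc _ ≤ c * n := h n
    _ ≤ ε ^ 2 * n * n := by gcongr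
    _ = (ε * n) ^ 2 := by ring

lemma exists_bits_of_predictable {ι : Type*} [Countable ι] (F : ι → ℕ → (ℕ → Bool) → ℝ)
    (q : ι → ℕ) (hF : ∀ a n b, |F a n b| ≤ 1)
    (hpast : ∀ a n b b', (∀ i < q a + n, b i = b' i) → F a n b = F a n b') :
    ∃ b : ℕ → Bool, ∀ a, ∀ ε > 0, UpperMeanLE (fun n => sign (b (q a + n)) * F a n b) ε := by
  obtain ⟨b, hb⟩ := exists_bits_sq_sum_le
    (fun a m b => if q a ≤ m then F a (m - q a) b else 0)
    (fun a m b => by split_ifs <;> simp [hF])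
    (fun a m b b' h => by
      split_ifs with hm
      · exact hpast a _ b b' fun i hi => h i (by omega)
      · rfl)
  refine ⟨b, fun a ε hε => ?_⟩
  obtain ⟨c, hc⟩ := hb a
  simpa using (UpperMeanLE.of_sq_sum_le (half_pos hε) hc).shift (half_lt_self hε) (q a)

lemma UpperMeanLE.abs_of_sq {f : ℕ → ℝ} {ε : ℝ} (hε : 0 < ε)
    (h : UpperMeanLE (fun i => f i ^ 2) (ε ^ 2)) : UpperMeanLE (fun i => |f i|) ε := by
  refine ((UpperMeanLE.const (ε / 2)).add (h.const_mul (a := (2 * ε)⁻¹) (by positivity))).mono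
    (fun i => ?_) (le_of_eq (by field_simp; norm_num))
  have hsq : ε / 2 + (2 * ε)⁻¹ * f i ^ 2 - |f i| = (|f i| - ε) ^ 2 / (2 * ε) := by
    rw [← sq_abs (f i)]; field_simp; ring
  exact sub_nonneg.1 (hsq ▸ by positivity)

lemma upperMeanLE_windowMean_sq {g : ℕ → ℝ} (hg : ∀ i, |g i| ≤ 1)
    (h : ∀ k, ∀ ε > 0, UpperMeanLE (fun i => g i * g (i + (k + 1))) ε) {N : ℕ} (hN : 0 < N) :
    UpperMeanLE (fun i => windowMean g N i ^ 2) (2 / N) := by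
  have hN' : (0 : ℝ) < N := by exact_mod_cast hN
  have hlt : ∀ j k, j < k → UpperMeanLE (fun i => g (i + j) * g (i + k)) (1 / N) := by
    intro j k hjk
    obtain ⟨d, rfl⟩ := Nat.exists_eq_add_of_lt hjk
    refine ((h d _ (half_pos (one_div_pos.2 hN'))).shift (half_lt_self (by positivity)) j).mono
      (fun i => le_of_eq ?_) le_rfl
    rw [add_comm j i, add_assoc, add_assoc]
  have hpair : ∀ j k, UpperMeanLE (fun i => g (i + j) * g (i + k))
      ((if j = k then 1 else 0) + 1 / N) := by
    intro j k
    rcases lt_trichotomy j k with hjk | rfl | hjk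
    · simpa [hjk.ne] using hlt j k hjk
    · refine (UpperMeanLE.const 1).mono (fun i => ?_) (by simp)
      rw [← abs_mul_abs_self]
      exact mul_le_one₀ (hg _) (abs_nonneg _) (hg _)
    · simpa [hjk.ne', mul_comm] using hlt k j hjk
  refine ((UpperMeanLE.sum (range N) fun j _ => UpperMeanLE.sum (range N) fun k _ =>
    hpair j k).const_mul (a := 1 / (N : ℝ) ^ 2) (by positivity)).mono (fun i => ?_) ?_
  · rw [windowMean, div_pow, sq, Finset.sum_mul_sum, one_div_mul_eq_div]
  · have hrow : ∀ j ∈ range N, ∑ k ∈ range N, ((if j = k then (1 : ℝ) else 0) + 1 / N) = 2 :=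
      fun j hj => by
        rw [Finset.sum_add_distrib, Finset.sum_ite_eq, if_pos hj, Finset.sum_const,
          Finset.card_range, nsmul_eq_mul, mul_one_div_cancel hN'.ne']
        norm_num
    rw [Finset.sum_congr rfl hrow, Finset.sum_const, Finset.card_range, nsmul_eq_mul]
    exact le_of_eq (by field_simp)

/-- A van der Corput lemma: the second moment of the window means is an average of
autocorrelations. -/
lemma hasMean_zero_of_autocorrelation {g : ℕ → ℝ} (hg : ∀ i, |g i| ≤ 1)
    (h : ∀ k, ∀ ε > 0, UpperMeanLE (fun i => g i * g (i + (k + 1))) ε) : HasMean g 0 := by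
  intro ε hε
  filter_upwards [eventually_const_le (sq_pos_of_pos hε) 2, eventually_gt_atTop 0] with N hN hN0
  simp only [sub_zero]
  refine .abs_of_sq hε ((upperMeanLE_windowMean_sq hg h hN0).mono (fun i => le_rfl) ?_)
  exact (div_le_iff₀ (by exact_mod_cast hN0)).2 hN

/-- In the autocorrelation with lag `k + 1` the sign at the last position `k + 1 + max T` occurs
once, so that it is a predictable multiple of that sign. -/
lemma exists_bits_hasMean_zero {ι : Type*} [Countable ι] {c : ι → ℕ → ℝ}
    (hc : ∀ a i, |c a i| ≤ 1) : ∃ b : ℕ → Bool, ∀ a, ∀ T : Finset ℕ, T.Nonempty →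
      HasMean (fun i => c a i * ∏ t ∈ T, sign (b (i + t))) 0 := by
  let F : ι × Finset ℕ × ℕ → ℕ → (ℕ → Bool) → ℝ := fun ⟨a, T, k⟩ i b =>
    c a i * c a (i + (k + 1)) * ((∏ t ∈ T, sign (b (i + t))) *
      ∏ t ∈ T.erase (T.sup id), sign (b (i + (k + 1) + t)))
  have hle : ∀ T : Finset ℕ, ∀ t ∈ T, t ≤ T.sup id := fun T t ht => Finset.le_sup (f := id) ht
  obtain ⟨b, hb⟩ := exists_bits_of_predictable F (fun a => a.2.2 + 1 + a.2.1.sup id)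
    (fun ⟨a, T, k⟩ i b => by
      simp only [F]
      rw [abs_mul, abs_mul, abs_mul, abs_prod_sign T fun t => b (i + t),
        abs_prod_sign _ fun t => b (i + (k + 1) + t), mul_one, mul_one]
      exact mul_le_one₀ (hc _ _) (abs_nonneg _) (hc _ _))
    (fun ⟨a, T, k⟩ i b b' h => by
      simp only [F] at h ⊢
      congr 2
      · refine Finset.prod_congr rfl fun t ht => ?_
        have := hle T t ht
        rw [h _ (by omega)]
      · refine Finset.prod_congr rfl fun t ht => ?_
        have := hle T t (Finset.mem_of_mem_erase ht)
        have := Finset.ne_of_mem_erase ht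
        rw [h _ (by omega)])
  refine ⟨b, fun a T hT => hasMean_zero_of_autocorrelation (fun i => ?_) fun k ε hε => ?_⟩
  · rw [abs_mul, abs_prod_sign T fun t => b (i + t), mul_one]
    exact hc a i
  · refine (hb (a, T, k) ε hε).mono (fun i => le_of_eq ?_) le_rfl
    have hmax : T.sup id ∈ T := by
      obtain ⟨t, ht, heq⟩ := Finset.exists_mem_eq_sup T hT id
      exact heq ▸ ht
    simp only [F]
    rw [← Finset.mul_prod_erase T (fun t => sign (b (i + (k + 1) + t))) hmax,
      show k + 1 + T.sup id + i = i + (k + 1) + T.sup id by omega]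
    ring

/-- The indicator of an occurrence of the pattern `u` in `y` at position `i`. -/
noncomputable def pat {m : ℕ} (y : ℕ → A) (u : Fin m → A) (i : ℕ) : ℝ :=
  ind (∀ t : Fin m, y (i + t) = u t)

lemma abs_pat_le_one {m : ℕ} (y : ℕ → A) (u : Fin m → A) (i : ℕ) : |pat y u i| ≤ 1 := by
  rw [pat, abs_of_nonneg (ind_nonneg _)]
  exact ind_le_one _

lemma pat_prodMk {m : ℕ} (y : ℕ → A) (b : ℕ → B) (u : Fin m → A × B) (i : ℕ) :
    pat (fun i => (y i, b i)) u i = pat y (fun t => (u t).1) i * pat b (fun t => (u t).2) i := by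
  simp only [pat, ← ind_and, ← forall_and, Prod.ext_iff]

lemma ErgSeq.hasMean_pat {m : ℕ} {y : ℕ → A} (hy : ErgSeq y) (u : Fin m → A) :
    ∃ c, HasMean (pat y u) c := by
  refine hy _ ⟨m, fun i j hw => propext (forall_congr' fun t => ?_)⟩
  rw [add_comm m i, add_comm m j, add_assoc, add_assoc, hw (m + t) (by omega)]

lemma LocalTo.exists_ind_eq_sum_pat [Fintype A] {w : ℕ → A} {v : ℕ → Prop} (h : LocalTo v w) :
    ∃ (D : ℕ) (c : (Fin (2 * D + 1) → A) → ℝ), ∀ i, ind (v (D + i)) = ∑ u, c u * pat w u i := by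
  classical
  obtain ⟨D, hD⟩ := h
  refine ⟨D, fun u => ind (∃ j, (∀ t : Fin (2 * D + 1), w (j + t) = u t) ∧ v (D + j)),
    fun i => ?_⟩
  rw [Finset.sum_eq_single fun t : Fin (2 * D + 1) => w (i + t)]
  · rw [pat, ind_of fun _ => rfl, mul_one]
    congr 1
    refine propext ⟨fun hi => ⟨i, fun _ => rfl, hi⟩, fun ⟨j, hj, hvj⟩ => ?_⟩
    rwa [hD i j fun t ht => (hj ⟨t, by omega⟩).symm]
  · exact fun u _ hu => by rw [pat, ind_of_not fun h => hu (funext fun t => (h t).symm), mul_zero]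
  · exact fun h => absurd (Finset.mem_univ _) h

lemma ergSeq_of_hasMean_pat [Finite A] {w : ℕ → A}
    (h : ∀ (m : ℕ) (u : Fin m → A), ∃ c, HasMean (pat w u) c) : ErgSeq w := by
  have := Fintype.ofFinite A
  intro v hv
  obtain ⟨D, a, ha⟩ := hv.exists_ind_eq_sum_pat
  choose c hc using h (2 * D + 1)
  refine ⟨_, HasMean.of_shift (k := D) (c := ∑ u, a u * c u) ?_⟩
  simp only [ha]
  exact HasMean.sum _ fun u _ => (hc u).const_mul (a u)

/-- Fourier expansion over the characters of `(ℤ/2)ᵐ`. -/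
lemma pat_bool_sub_eq {m : ℕ} (b : ℕ → Bool) (v : Fin m → Bool) (i : ℕ) :
    pat b v i - (1 / 2) ^ m =
      ∑ T ∈ (Finset.univ.powerset.erase ∅ : Finset (Finset (Fin m))),
        ((1 / 2) ^ m * ∏ t ∈ T, sign (v t)) *
          ∏ t ∈ T.map Fin.valEmbedding, sign (b (i + t)) := by
  rw [pat, ind_forall]
  simp only [ind_bool_eq, div_eq_mul_inv, Finset.prod_mul_distrib]
  rw [Finset.prod_one_add, Finset.prod_const, Finset.card_univ, Fintype.card_fin,
    ← Finset.add_sum_erase _ _ (Finset.empty_mem_powerset _), Finset.prod_empty, add_mul,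
    one_mul, one_mul, add_sub_cancel_left, Finset.sum_mul]
  refine Finset.sum_congr rfl fun T _ => ?_
  rw [Finset.prod_map, Finset.prod_mul_distrib]
  simp only [Fin.valEmbedding_apply]
  ring

lemma ErgSeq.exists_relatively_normal [Finite A] {y : ℕ → A} (hy : ErgSeq y) :
    ∃ b : ℕ → Bool, ErgSeq (fun i => (y i, b i)) ∧ ∀ (m : ℕ) (v : Fin m → Bool),
      HasMean (pat b v) ((1 / 2) ^ m) := by
  obtain ⟨b, hb⟩ := exists_bits_hasMean_zero
    (c := fun (a : Σ m : ℕ, Fin m → A) i => pat y a.2 i) fun a i => abs_pat_le_one y a.2 i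
  have hjoint : ∀ (k : ℕ) (u : Fin k → A) (m : ℕ) (v : Fin m → Bool),
      HasMean (fun i => pat y u i * (pat b v i - (1 / 2) ^ m)) 0 := by
    intro k u m v
    have hterm := HasMean.sum (Finset.univ.powerset.erase ∅ : Finset (Finset (Fin m)))
      fun T hT => (hb ⟨k, u⟩ (T.map Fin.valEmbedding) ((Finset.map_nonempty).2
        (Finset.nonempty_iff_ne_empty.2 (Finset.ne_of_mem_erase hT)))).const_mul
          ((1 / 2) ^ m * ∏ t ∈ T, sign (v t))
    simpa only [pat_bool_sub_eq, Finset.mul_sum, mul_zero, Finset.sum_const_zero,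
      mul_left_comm] using hterm
  refine ⟨b, ergSeq_of_hasMean_pat fun m u => ?_, fun m v => ?_⟩
  · obtain ⟨c, hc⟩ := hy.hasMean_pat fun t => (u t).1
    have hsplit : pat (fun i => (y i, b i)) u = fun i =>
        (1 / 2) ^ m * pat y (fun t => (u t).1) i + pat y (fun t => (u t).1) i *
          (pat b (fun t => (u t).2) i - (1 / 2) ^ m) := by
      funext i
      rw [pat_prodMk]
      ring
    exact hsplit ▸ ⟨_, (hc.const_mul _).add (hjoint m _ m _)⟩
  · have hone : ∀ i, pat y Fin.elim0 i = 1 := fun i => ind_of fun t => t.elim0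
    simpa only [hone, one_mul, sub_add_cancel, zero_add] using
      (hjoint 0 Fin.elim0 m v).add (.const ((1 / 2) ^ m))

/-! ### Markers -/

/-- `C` is a set of cut points containing `0`, with spacing at least `lo` and gaps at most `hi`. -/
def IsCut (C : Set ℕ) (lo hi : ℕ) : Prop :=
  0 ∈ C ∧ (∀ p ∈ C, ∀ q ∈ C, p < q → p + lo ≤ q) ∧ ∀ i, ∃ q ∈ C, i < q ∧ q ≤ i + hi

/-- The cut points obtained by dividing the stretches between consecutive points of `M` into
pieces of length `L`, where the last piece takes up the remainder. -/
def subdivide (L : ℕ) (M : Set ℕ) : Set ℕ :=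
  {i | ∃ m ∈ M, m ≤ i ∧ (∀ k ∈ M, m < k → i < k) ∧ L ∣ i - m ∧
    (i = m ∨ ∀ k ∈ M, i < k → i + L ≤ k)}

lemma subset_subdivide (L : ℕ) (M : Set ℕ) : M ⊆ subdivide L M := fun m hm =>
  ⟨m, hm, le_rfl, fun _ _ h => h, by simp, Or.inl rfl⟩

lemma exists_last_le {M : Set ℕ} (h0 : 0 ∈ M) (i : ℕ) :
    ∃ m ∈ M, m ≤ i ∧ ∀ k ∈ M, m < k → i < k := by
  classical
  refine ⟨Nat.findGreatest (· ∈ M) i, Nat.findGreatest_spec (P := (· ∈ M)) i.zero_le h0,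
    Nat.findGreatest_le i, fun k hk hmk => ?_⟩
  by_contra! hki
  exact Nat.findGreatest_is_greatest hmk hki hk

lemma isCut_subdivide {M : Set ℕ} {L : ℕ} (hL : 0 < L) (h0 : 0 ∈ M)
    (hM : ∀ p ∈ M, ∀ q ∈ M, p < q → p + L ≤ q) : IsCut (subdivide L M) L (2 * L) := by
  refine ⟨subset_subdivide L M h0, ?_, fun i => ?_⟩
  · rintro p ⟨m, hm, hmp, hmk, hd, hp⟩ q ⟨m', hm', hmq, hmk', hd', hq⟩ hpq
    rcases lt_trichotomy m m' with h | rfl | h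
    · have hpm' := hmk m' hm' h
      rcases hp with rfl | hp
      · have := hM p hm m' hm' h; omega
      · have := hp m' hm' hpm'; omega
    · have := Nat.le_of_dvd (by omega) (Nat.dvd_sub hd' hd : L ∣ (q - m) - (p - m))
      omega
    · have := hmk' m hm h; omega
  · obtain ⟨m, hm, hmi, hlast⟩ := exists_last_le h0 i
    obtain ⟨x, hx, hix, hxi⟩ : ∃ x, L ∣ x - m ∧ i < x ∧ x ≤ i + L := by
      have hdm := Nat.div_add_mod (i - m) L
      have hlt := Nat.mod_lt (i - m) hL
      refine ⟨m + L * ((i - m) / L + 1), by simp, ?_, ?_⟩ <;> rw [mul_add_one] <;> omega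
    by_cases hk : ∃ k ∈ M, i < k ∧ k < x + L
    · obtain ⟨k, hkM, hik, hkx⟩ := hk
      exact ⟨k, subset_subdivide L M hkM, hik, by omega⟩
    · push Not at hk
      refine ⟨x, ⟨m, hm, by omega, fun k hkM hmk => ?_, hx, Or.inr fun k hkM hxk =>
        hk k hkM (by omega)⟩, hix, by omega⟩
      have := hk k hkM (hlast k hkM hmk)
      omega

lemma add_mem_subdivide_of_agree {L N x x' : ℕ} {M M' : Set ℕ}
    (hL : 0 < L) (hagree : ∀ s < N + L, x + s ∈ M ↔ x' + s ∈ M') (hex : ∃ t ≤ N, x + t ∈ M)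
    (h : x + N ∈ subdivide L M) : x' + N ∈ subdivide L M' := by
  obtain ⟨m, hm, hmN, hlast, hd, hor⟩ := h
  obtain ⟨t, htN, ht⟩ := hex
  obtain ⟨s, rfl⟩ : ∃ s, m = x + s := by
    refine Nat.exists_eq_add_of_le (not_lt.1 fun hlt => ?_)
    have := hlast _ ht (by omega)
    omega
  refine ⟨x' + s, (hagree s (by omega)).1 hm, by omega, fun k hk hsk => ?_, ?_, ?_⟩
  · by_contra! hkN
    obtain ⟨j, rfl⟩ := Nat.exists_eq_add_of_le (show x' ≤ k by omega)
    have := hlast _ ((hagree j (by omega)).2 hk) (by omega)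
    omega
  · rwa [Nat.add_sub_add_left] at hd ⊢
  · refine hor.imp (fun h => by omega) fun h k hk hNk => ?_
    by_contra! hkL
    obtain ⟨j, rfl⟩ := Nat.exists_eq_add_of_le (show x' ≤ k by omega)
    have := h _ ((hagree j (by omega)).2 hk) (by omega)
    omega

/-- Whether `i` belongs to `subdivide L M` can be read off from a window of `M` around `i` that
contains a point of `M` before `i`. -/
lemma factorOf_subdivide {M : Set ℕ} {L : ℕ} (hL : 0 < L)
    (hgap : ∀ η > 0, ∃ N, UpperMeanLE (fun i => ind (∀ t ≤ N, i + t ∉ M)) η) :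
    FactorOf (· ∈ subdivide L M) (· ∈ M) := by
  intro η hη
  obtain ⟨N, hN⟩ := hgap (η / 2) (half_pos hη)
  refine ⟨fun i => (∃ t ≤ N, i - N + t ∈ M) ∧ i ∈ subdivide L M,
    ⟨N + L, fun i j hw => ?_⟩, .of_shift (k := N) ?_ (half_lt_self hη)⟩
  · have hagree : ∀ s < N + L, L + i + s ∈ M ↔ L + j + s ∈ M := fun s hs => by
      simpa only [add_assoc, add_left_comm] using (hw (L + s) (by omega)).to_iff
    have hex : (∃ t ≤ N, L + i + t ∈ M) ↔ ∃ t ≤ N, L + j + t ∈ M :=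
      exists_congr fun t => and_congr_right fun ht => hagree t (by omega)
    beta_reduce
    rw [show N + L + i = L + i + N by omega, show N + L + j = L + j + N by omega,
      Nat.add_sub_cancel, Nat.add_sub_cancel, hex]
    exact propext (and_congr_right fun hj =>
      ⟨add_mem_subdivide_of_agree hL hagree (hex.2 hj),
        add_mem_subdivide_of_agree hL (fun s hs => (hagree s hs).symm) hj⟩)
  · refine hN.mono (fun i => ind_mono fun hne t ht hmem => hne ?_) le_rfl
    simp only [Nat.add_sub_cancel_left]
    exact propext (and_iff_right ⟨t, ht, hmem⟩).symm

lemma HasMean.exists_gap_upperMeanLE {P : ℕ → Prop} {c : ℝ} (h : HasMean (fun i => ind (P i)) c)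
    (hc : 0 < c) {η : ℝ} (hη : 0 < η) :
    ∃ N, UpperMeanLE (fun i => ind (∀ t ≤ N, ¬ P (i + t))) η := by
  obtain ⟨N, hN⟩ := (h (c * η) (by positivity)).exists
  refine ⟨N, (hN.const_mul (inv_pos.2 hc).le).mono (fun i => ?_) (by field_simp; rfl)⟩
  by_cases hgap : ∀ t ≤ N, ¬ P (i + t)
  · have hzero : windowMean (fun i => ind (P i)) N i = 0 := by
      rw [windowMean, Finset.sum_eq_zero fun t ht =>
        ind_of_not (hgap t (Finset.mem_range.1 ht).le), zero_div]
    rw [ind_of hgap, hzero, zero_sub, abs_neg, abs_of_pos hc, inv_mul_cancel₀ hc.ne']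
  · rw [ind_of_not hgap]
    positivity

/-- The pattern `0 ⋯ 0 1` does not overlap itself. -/
lemma exists_markers {b : ℕ → Bool}
    (hb : ∀ (m : ℕ) (v : Fin m → Bool), HasMean (pat b v) ((1 / 2) ^ m)) {L : ℕ} (hL : 0 < L) :
    ∃ M : Set ℕ, 0 ∈ M ∧ (∀ p ∈ M, ∀ q ∈ M, p < q → p + L ≤ q) ∧ LocalTo (· ∈ M) b ∧
      ∀ η > 0, ∃ N, UpperMeanLE (fun i => ind (∀ t ≤ N, i + t ∉ M)) η := by
  let v : Fin L → Bool := fun t => decide ((t : ℕ) + 1 = L)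
  let P : ℕ → Prop := fun i => ∀ t : Fin L, b (i + t) = v t
  have hsparse : ∀ p q, P p → P q → p < q → p + L ≤ q := by
    intro p q hp hq hpq
    by_contra! hlt
    have hpL := hp ⟨L - 1, by omega⟩
    have hqL := hq ⟨p + L - 1 - q, by omega⟩
    simp only [v] at hpL hqL
    rw [decide_eq_true (by omega)] at hpL
    rw [decide_eq_false (by omega), show q + (p + L - 1 - q) = p + (L - 1) by omega, hpL] at hqL
    exact absurd hqL (by simp)
  refine ⟨{i | i = 0 ∨ L ≤ i ∧ P i}, Or.inl rfl, ?_, ⟨L, fun i j hw => ?_⟩, fun η hη => ?_⟩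
  · rintro p (rfl | ⟨_, hp⟩) q (rfl | ⟨hqL, hq⟩) hpq
    · omega
    · omega
    · omega
    · exact hsparse p q hp hq hpq
  · have hP : P (L + i) ↔ P (L + j) := forall_congr' fun t => by
      rw [add_comm L i, add_comm L j, add_assoc, add_assoc, hw (L + t) (by omega)]
    simp [hP, hL.ne']
  · obtain ⟨N, hN⟩ := (hb L v).exists_gap_upperMeanLE (by positivity) (half_pos (half_pos hη))
    refine ⟨N, .of_shift (k := L) ?_ (half_lt_self hη)⟩
    exact (hN.shift (half_lt_self (half_pos hη)) L).mono (fun i => ind_mono fun h t ht hPt =>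
      h t ht (Or.inr ⟨by omega, hPt⟩)) le_rfl

lemma FactorOf.trans_localTo {u : ℕ → A} {v : ℕ → B} {w : ℕ → C} (huv : FactorOf u v)
    (hvw : LocalTo v w) : FactorOf u w := fun η hη =>
  let ⟨u', hu', huu'⟩ := huv η hη
  ⟨u', hu'.trans hvw, huu'⟩

lemma exists_isCut_factorOf {b : ℕ → Bool}
    (hb : ∀ (m : ℕ) (v : Fin m → Bool), HasMean (pat b v) ((1 / 2) ^ m)) {L : ℕ} (hL : 0 < L) :
    ∃ ρ : Set ℕ, IsCut ρ L (2 * L) ∧ FactorOf (· ∈ ρ) b := by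
  obtain ⟨M, h0, hM, hlocal, hgap⟩ := exists_markers hb hL
  exact ⟨subdivide L M, isCut_subdivide hL h0 hM, (factorOf_subdivide hL hgap).trans_localTo hlocal⟩

/-! ### Words and their frequencies -/

/-- The word of length `m` occurring in `y` at the position `p`. -/
def word (y : ℕ → A) (p m : ℕ) : List A := (List.range m).map fun t => y (p + t)

@[simp] lemma length_word (y : ℕ → A) (p m : ℕ) : (word y p m).length = m := by simp [word]

lemma word_eq_word_iff {y y' : ℕ → A} {p p' m : ℕ} :
    word y p m = word y' p' m ↔ ∀ t < m, y (p + t) = y' (p' + t) := by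
  simp [word]

lemma word_add (y : ℕ → A) (p m n : ℕ) : word y p (m + n) = word y p m ++ word y (p + m) n := by
  simp [word, List.range_add, Function.comp_def, add_assoc]

lemma word_append_word (y : ℕ → A) {p q r : ℕ} (hpq : p ≤ q) (hqr : q ≤ r) :
    word y p (q - p) ++ word y q (r - q) = word y p (r - p) := by
  obtain ⟨m, rfl⟩ := Nat.exists_eq_add_of_le hpq
  obtain ⟨n, rfl⟩ := Nat.exists_eq_add_of_le hqr
  rw [Nat.add_sub_cancel_left, Nat.add_sub_cancel_left, add_assoc, Nat.add_sub_cancel_left,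
    word_add]

lemma word_prefix_word (y : ℕ → A) (p : ℕ) {m n : ℕ} (h : m ≤ n) : word y p m <+: word y p n := by
  obtain ⟨k, rfl⟩ := Nat.exists_eq_add_of_le h
  rw [word_add]
  exact List.prefix_append _ _

lemma drop_word (y : ℕ → A) (p : ℕ) {m j : ℕ} (h : j ≤ m) :
    (word y p m).drop j = word y (p + j) (m - j) := by
  obtain ⟨k, rfl⟩ := Nat.exists_eq_add_of_le h
  rw [word_add, List.drop_left' (length_word y p j), Nat.add_sub_cancel_left]

lemma getElem?_word (y : ℕ → A) (p : ℕ) {m t : ℕ} (ht : t < m) :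
    (word y p m)[t]? = some (y (p + t)) := by
  simp [word, ht]

lemma prefix_word_iff {y : ℕ → A} {p m : ℕ} {u : List A} (hm : u.length ≤ m) :
    u <+: word y p m ↔ word y p u.length = u := by
  refine ⟨fun h => ?_, fun h => h ▸ by simpa using word_prefix_word y p hm⟩
  exact (List.prefix_of_prefix_length_le (word_prefix_word y p hm) h (by simp)).eq_of_length
    (by simp)

lemma eq_word_of_word_eq_append {y : ℕ → A} {p n : ℕ} {u v : List A} (h : word y p n = u ++ v) :
    word y p u.length = u ∧ word y (p + u.length) v.length = v := by
  obtain rfl : n = u.length + v.length := by simpa using congrArg List.length h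
  rw [word_add] at h
  exact List.append_inj h (by simp)

lemma exists_word_eq_of_isInfix {y : ℕ → A} {p n : ℕ} {u : List A} (h : u <:+: word y p n) :
    ∃ j, j + u.length ≤ n ∧ word y (p + j) u.length = u := by
  obtain ⟨s, t, h⟩ := h
  have hl : s.length + u.length + t.length = n := by simpa [add_assoc] using congrArg List.length h
  exact ⟨s.length, by omega,
    (eq_word_of_word_eq_append (eq_word_of_word_eq_append h.symm).1).2⟩

lemma sum_ind_nonneg (P : ℕ → Prop) (n : ℕ) : 0 ≤ ∑ j ∈ range n, ind (P j) :=
  Finset.sum_nonneg fun _ _ => ind_nonneg _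

lemma sum_ind_le (P : ℕ → Prop) (n : ℕ) : ∑ j ∈ range n, ind (P j) ≤ n := by
  simpa using Finset.sum_le_sum fun j (_ : j ∈ range n) => ind_le_one (P j)

lemma not_of_sum_ind_le_zero {P : ℕ → Prop} {n i : ℕ} (h : ∑ j ∈ range n, ind (P j) ≤ 0)
    (hi : i < n) : ¬P i := fun hP => by
  have hle := Finset.single_le_sum (fun j _ => ind_nonneg (P j)) (Finset.mem_range.2 hi)
  rw [ind_of hP] at hle
  linarith

/-- Only the last `k` terms of a sum over `range n` can have an index `j` with `n < j + k`. -/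
lemma sum_ind_le_add {P Q : ℕ → Prop} {n k : ℕ} (h : ∀ j, j + k ≤ n → P j → Q j) :
    ∑ j ∈ range n, ind (P j) ≤ ∑ j ∈ range n, ind (Q j) + k := by
  rcases le_total n k with hnk | hkn
  · exact ((sum_ind_le P n).trans (Nat.cast_le.2 hnk)).trans
      (le_add_of_nonneg_left (sum_ind_nonneg Q n))
  · obtain ⟨d, rfl⟩ := Nat.exists_eq_add_of_le' hkn
    rw [Finset.sum_range_add, Finset.sum_range_add, add_assoc]
    gcongr with j hj
    · exact ind_mono (h j (by have := Finset.mem_range.1 hj; omega))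
    · exact (sum_ind_le _ k).trans (le_add_of_nonneg_left (sum_ind_nonneg _ k))

/-- The number of occurrences of `u` in `v`. -/
noncomputable def occ (u v : List A) : ℝ := ∑ j ∈ range v.length, ind (u <+: v.drop j)

lemma occ_append (u v₁ v₂ : List A) :
    occ u (v₁ ++ v₂) = ∑ j ∈ range v₁.length, ind (u <+: v₁.drop j ++ v₂) + occ u v₂ := by
  rw [occ, List.length_append, Finset.sum_range_add, occ]
  congr 1
  · refine Finset.sum_congr rfl fun j hj => ?_
    rw [List.drop_append_of_le_length (Finset.mem_range.1 hj).le]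
  · simp only [List.drop_length_add_append]

lemma abs_occ_append_sub_le (u v₁ v₂ : List A) : |occ u (v₁ ++ v₂) - occ u v₂| ≤ v₁.length := by
  rw [occ_append, add_sub_cancel_right, abs_of_nonneg (sum_ind_nonneg _ _)]
  exact sum_ind_le _ _

lemma occ_add_occ_le (u v₁ v₂ : List A) : occ u v₁ + occ u v₂ ≤ occ u (v₁ ++ v₂) := by
  rw [occ_append, occ]
  gcongr with j
  exact ind_mono fun h => h.trans (List.prefix_append _ _)

lemma occ_append_le (u v₁ v₂ : List A) :
    occ u (v₁ ++ v₂) ≤ occ u v₁ + occ u v₂ + u.length := by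
  rw [occ_append, add_right_comm]
  gcongr
  exact sum_ind_le_add fun j hj h =>
    List.prefix_of_prefix_length_le h (List.prefix_append _ _) (by rw [List.length_drop]; omega)

lemma abs_occ_word_sub_sum_le (y : ℕ → A) (u : List A) (p m : ℕ) :
    |occ u (word y p m) - ∑ j ∈ range m, ind (word y (p + j) u.length = u)| ≤ u.length := by
  have hoccurs : ∀ j, j + u.length ≤ m →
      (u <+: (word y p m).drop j ↔ word y (p + j) u.length = u) := fun j hj => by
    rw [drop_word y p (by omega), prefix_word_iff (by omega)]
  rw [occ, length_word, abs_sub_le_iff, sub_le_iff_le_add', sub_le_iff_le_add']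
  exact ⟨sum_ind_le_add fun j hj => (hoccurs j hj).1, sum_ind_le_add fun j hj => (hoccurs j hj).2⟩

lemma abs_sum_windowMean_sub_sum_le {g : ℕ → ℝ} (h0 : ∀ i, 0 ≤ g i) (h1 : ∀ i, g i ≤ 1) {N : ℕ}
    (hN : N ≠ 0) (n : ℕ) :
    |∑ i ∈ range n, windowMean g N i - ∑ i ∈ range n, g i| ≤ N := by
  have hcompl : ∀ i, windowMean (fun i => 1 - g i) N i = 1 - windowMean g N i := fun i => by
    simp [windowMean, sub_div, hN]
  have hupper := sum_windowMean_le h0 N n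
  have hlower := sum_windowMean_le (fun i => sub_nonneg.2 (h1 i)) N n
  have hnonneg : 0 ≤ ∑ i ∈ range N, g (n + i) := Finset.sum_nonneg fun _ _ => h0 _
  have hle : ∑ i ∈ range N, g (n + i) ≤ N := by
    simpa using Finset.sum_le_sum fun i (_ : i ∈ range N) => h1 (n + i)
  simp only [hcompl, Finset.sum_sub_distrib, Finset.sum_const, Finset.card_range, nsmul_eq_mul,
    mul_one, Nat.cast_add] at hlower
  rw [Finset.sum_range_add] at hupper hlower
  rw [abs_sub_le_iff]
  constructor <;> linarith

lemma abs_occ_word_sub_mul_le (y : ℕ → A) (u : List A) (c : ℝ) {N : ℕ} (hN : N ≠ 0) (p l : ℕ) :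
    |occ u (word y p l) - c * l| ≤ ∑ j ∈ range l,
      |windowMean (fun i => ind (word y i u.length = u)) N (p + j) - c| + (N + u.length) := by
  set g : ℕ → ℝ := fun i => ind (word y i u.length = u)
  have hocc : |occ u (word y p l) - ∑ j ∈ range l, g (p + j)| ≤ u.length :=
    abs_occ_word_sub_sum_le y u p l
  have hwindow : |∑ j ∈ range l, windowMean g N (p + j) - ∑ j ∈ range l, g (p + j)| ≤ N := by
    simpa only [windowMean, add_assoc] using abs_sum_windowMean_sub_sum_le
      (g := fun i => g (p + i)) (fun _ => ind_nonneg _) (fun _ => ind_le_one _) hN l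
  have hmean : |∑ j ∈ range l, windowMean g N (p + j) - c * l|
      ≤ ∑ j ∈ range l, |windowMean g N (p + j) - c| := by
    simpa [Finset.sum_sub_distrib, mul_comm] using
      Finset.abs_sum_le_sum_abs (fun j => windowMean g N (p + j) - c) (range l)
  rw [abs_le] at *
  constructor <;> linarith

/-! ### Replacing blocks -/

/-- The total deviation, over the words `u ∈ U`, of the number of occurrences of `u` in `v` from
the number `c u * v.length` expected for the frequency `c u`. -/
noncomputable def discrepancy (U : Finset (List A)) (c : List A → ℝ) (v : List A) : ℝ :=
  ∑ u ∈ U, |occ u v - c u * v.length|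

lemma discrepancy_append_le (U : Finset (List A)) (c : List A → ℝ) (h t : List A) :
    discrepancy U c (h ++ t) ≤ discrepancy U c t + (∑ u ∈ U, (1 + |c u|)) * h.length := by
  rw [discrepancy, discrepancy, Finset.sum_mul, ← Finset.sum_add_distrib]
  refine Finset.sum_le_sum fun u _ => ?_
  have hsplit : occ u (h ++ t) - c u * (h ++ t).length = (occ u t - c u * t.length)
      + (occ u (h ++ t) - occ u t) + -(c u * h.length) := by
    rw [List.length_append]; push_cast; ring
  have hocc := abs_occ_append_sub_le u h t
  have habs := abs_add_three (occ u t - c u * t.length) (occ u (h ++ t) - occ u t)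
    (-(c u * h.length))
  rw [abs_neg, abs_mul, Nat.abs_cast] at habs
  rw [hsplit]
  linarith

lemma FactorOf.exists_hasMean_word {w : ℕ → B} {y : ℕ → A} (hy : FactorOf y w) (hw : ErgSeq w)
    (u : List A) : ∃ c, HasMean (fun i => ind (word y i u.length = u)) c := by
  refine FactorOf.hasMean (LocalTo.factorOf_trans ⟨u.length, fun i j h => ?_⟩ hy) hw
  have hword : word y (u.length + i) u.length = word y (u.length + j) u.length :=
    word_eq_word_iff.2 fun t ht => by
      simpa only [add_assoc, add_left_comm] using h (u.length + t) (by omega)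
  simp only [hword]

lemma FactorOf.exists_discrepancy_word_le {w : ℕ → B} {y : ℕ → A} (hy : FactorOf y w)
    (hw : ErgSeq w) (U : Finset (List A)) : ∃ c : List A → ℝ, ∀ η > 0, ∃ (e : ℕ → ℝ) (X : ℝ),
      (∀ i, 0 ≤ e i) ∧ UpperMeanLE e η ∧
      ∀ p l, discrepancy U c (word y p l) ≤ ∑ j ∈ range l, e (p + j) + X := by
  choose c hc using hy.exists_hasMean_word hw
  refine ⟨c, fun η hη => ?_⟩
  have hmeans : ∀ᶠ N in atTop, ∀ u ∈ U, UpperMeanLE (fun i =>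
      |windowMean (fun i => ind (word y i u.length = u)) N i - c u|) (η / (U.card + 1)) :=
    (Filter.eventually_all_finset U).2 fun u _ => hc u _ (by positivity)
  obtain ⟨N, hN, hN0⟩ := (hmeans.and (eventually_ne_atTop 0)).exists
  refine ⟨_, ∑ u ∈ U, (N + u.length : ℝ), fun i => Finset.sum_nonneg fun _ _ => abs_nonneg _,
    (UpperMeanLE.sum U hN).mono (fun _ => le_rfl) ?_, fun p l => ?_⟩
  · rw [Finset.sum_const, nsmul_eq_mul, mul_div_left_comm]
    exact mul_le_of_le_one_right hη.le ((div_le_one (by positivity)).2 (by linarith))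
  · rw [Finset.sum_comm, ← Finset.sum_add_distrib, discrepancy, length_word]
    exact Finset.sum_le_sum fun u _ => abs_occ_word_sub_mul_le y u (c u) hN0 p l

open Classical in
/-- The number of positions at which the word `v` differs from the word `u`. -/
noncomputable def mismatch (u v : List A) : ℕ :=
  ((range u.length).filter fun t => u[t]? ≠ v[t]?).card

lemma cast_mismatch_word (y z : ℕ → A) (p m : ℕ) :
    (mismatch (word y p m) (word z p m) : ℝ) = ∑ j ∈ range m, ind (y (p + j) ≠ z (p + j)) := by
  rw [mismatch, length_word, Finset.card_filter, Nat.cast_sum]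
  refine Finset.sum_congr rfl fun j hj => ?_
  have ht := Finset.mem_range.1 hj
  by_cases h : y (p + j) = z (p + j) <;> simp [getElem?_word _ _ ht, ind, h]

lemma mismatch_le_length (u v : List A) : mismatch u v ≤ u.length := by
  classical exact (Finset.card_filter_le _ _).trans_eq (Finset.card_range _)

@[simp] lemma mismatch_self (u : List A) : mismatch u u = 0 := by
  simp [mismatch]

lemma mismatch_append_le {u v : List A} (t : List A) (h : v.length = u.length) :
    mismatch (u ++ t) (v ++ t) ≤ u.length := by
  classical
  refine (Finset.card_le_card fun j hj => ?_).trans_eq (Finset.card_range _)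
  rw [Finset.mem_filter] at hj
  by_contra! hlen
  rw [Finset.mem_range, not_lt] at hlen
  exact hj.2 (by rw [List.getElem?_append_right hlen, List.getElem?_append_right (h ▸ hlen), h])

lemma exists_nearest_word {S : Set (List A)} {m : ℕ} (h : ∃ v ∈ S, v.length = m) (u : List A) :
    ∃ v ∈ S, v.length = m ∧ ∀ v' ∈ S, v'.length = m → mismatch u v ≤ mismatch u v' := by
  obtain ⟨v, ⟨hvS, hvm⟩, hmin⟩ := (measure (mismatch u)).wf.has_min {v | v ∈ S ∧ v.length = m} h
  exact ⟨v, hvS, hvm, fun v' hS hm => not_lt.1 (hmin v' ⟨hS, hm⟩)⟩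

/-- `p` and `q` are consecutive cut points. -/
def Consec (C : Set ℕ) (p q : ℕ) : Prop := p ∈ C ∧ q ∈ C ∧ p < q ∧ ∀ k ∈ C, p < k → q ≤ k

lemma Consec.eq_of_mem {C : Set ℕ} {p q p' q' i : ℕ} (h : Consec C p q) (h' : Consec C p' q')
    (hp : p ≤ i) (hq : i < q) (hp' : p' ≤ i) (hq' : i < q') : p = p' ∧ q = q' := by
  obtain ⟨hpC, hqC, -, hnext⟩ := h
  obtain ⟨hpC', hqC', -, hnext'⟩ := h'
  obtain rfl : p = p' := le_antisymm
    (not_lt.1 fun hlt => by have := hnext' p hpC hlt; omega)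
    (not_lt.1 fun hlt => by have := hnext p' hpC' hlt; omega)
  exact ⟨rfl, le_antisymm (hnext q' hqC' (by omega)) (hnext' q hqC (by omega))⟩

lemma Consec.add_of_agree {C : Set ℕ} {i j n s r : ℕ} (hagree : ∀ t ≤ n, i + t ∈ C ↔ j + t ∈ C)
    (hr : r ≤ n) (h : Consec C (i + s) (i + r)) : Consec C (j + s) (j + r) := by
  obtain ⟨hs, hrC, hlt, hnext⟩ := h
  refine ⟨(hagree s (by omega)).1 hs, (hagree r hr).1 hrC, by omega, fun k hk hsk => ?_⟩
  by_contra! hkr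
  obtain ⟨t, rfl⟩ := Nat.exists_eq_add_of_le (show j ≤ k by omega)
  have := hnext _ ((hagree t (by omega)).2 hk) (by omega)
  omega

namespace IsCut

variable {C : Set ℕ} {lo hi : ℕ}

lemma exists_consec (hC : IsCut C lo hi) (i : ℕ) : ∃ p q, Consec C p q ∧ p ≤ i ∧ i < q := by
  classical
  obtain ⟨p, hp, hpi, hlast⟩ := exists_last_le hC.1 i
  have hex : ∃ q, q ∈ C ∧ i < q := (hC.2.2 i).imp fun q hq => ⟨hq.1, hq.2.1⟩
  obtain ⟨hqC, hiq⟩ := Nat.find_spec hex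
  exact ⟨p, Nat.find hex, ⟨hp, hqC, hpi.trans_lt hiq, fun k hk hpk =>
    Nat.find_min' hex ⟨hk, hlast k hk hpk⟩⟩, hpi, hiq⟩

lemma consec_le (hC : IsCut C lo hi) {p q : ℕ} (h : Consec C p q) : q ≤ p + hi := by
  obtain ⟨k, hk, hpk, hkp⟩ := hC.2.2 p
  exact (h.2.2.2 k hk hpk).trans hkp

lemma le_consec (hC : IsCut C lo hi) {p q : ℕ} (h : Consec C p q) : p + lo ≤ q :=
  hC.2.1 p h.1 q h.2.1 h.2.2.1

lemma induction_on (hC : IsCut C lo hi) {P : ℕ → Prop} {p q : ℕ} (hp : p ∈ C) (hq : q ∈ C)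
    (hpq : p ≤ q) (base : P p) (step : ∀ k r, p ≤ k → Consec C k r → P k → P r) : P q := by
  induction q using Nat.strong_induction_on with
  | _ q ih =>
    rcases hpq.eq_or_lt with rfl | hlt
    · exact base
    obtain ⟨k, r, hkr, hk, hr⟩ := hC.exists_consec (q - 1)
    have hqr := hkr.2.2.2 q hq (by omega)
    obtain rfl : q = r := by omega
    have hpk : p ≤ k := not_lt.1 fun h => by have := hkr.2.2.2 p hp h; omega
    exact step k q hpk hkr (ih k (by omega) hkr.1 hpk)

lemma sum_range_le (hC : IsCut C lo hi) {f g : ℕ → ℝ}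
    (h : ∀ p q, Consec C p q →
      ∑ j ∈ range (q - p), f (p + j) ≤ ∑ j ∈ range (q - p), g (p + j)) {q : ℕ} (hq : q ∈ C) :
    ∑ i ∈ range q, f i ≤ ∑ i ∈ range q, g i := by
  refine hC.induction_on (P := fun q => ∑ i ∈ range q, f i ≤ ∑ i ∈ range q, g i) hC.1 hq
    q.zero_le (by simp) fun p q _ hpq ih => ?_
  obtain ⟨l, rfl⟩ := Nat.exists_eq_add_of_le hpq.2.2.1.le
  have hblock := h p (p + l) hpq
  rw [Nat.add_sub_cancel_left] at hblock
  rw [Finset.sum_range_add, Finset.sum_range_add]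
  exact add_le_add ih hblock

end IsCut

/-- The points of `ρ`, each moved forward to the next point of `C`. -/
def alignTo (C ρ : Set ℕ) : Set ℕ := {q | q ∈ C ∧ ∃ p ∈ ρ, p ≤ q ∧ ∀ r ∈ C, p ≤ r → q ≤ r}

namespace IsCut

variable {C ρ : Set ℕ} {lo R L : ℕ}

lemma le_add_of_forall_le (hC : IsCut C lo R) {p q : ℕ} (h : ∀ r ∈ C, p ≤ r → q ≤ r) :
    q ≤ p + R :=
  let ⟨r, hr, hpr, hrp⟩ := hC.2.2 p
  (h r hr hpr.le).trans hrp

lemma alignTo (hC : IsCut C lo R) (hρ : IsCut ρ (L + R) (2 * (L + R))) :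
    IsCut (alignTo C ρ) L (2 * L + 3 * R) := by
  refine ⟨⟨hC.1, 0, hρ.1, le_rfl, fun r _ h => h⟩, ?_, fun i => ?_⟩
  · rintro q ⟨hq, p, hp, hpq, hmin⟩ q' ⟨-, p', hp', hpq', hmin'⟩ hqq
    have hqp := hC.le_add_of_forall_le hmin
    rcases lt_or_ge p p' with h | h
    · have := hρ.2.1 p hp p' hp' h
      omega
    · have := hmin' q hq (by omega)
      omega
  · classical
    obtain ⟨p, hp, hip, hpi⟩ := hρ.2.2 i
    have hex : ∃ q, q ∈ C ∧ p ≤ q := (hC.2.2 p).imp fun q hq => ⟨hq.1, hq.2.1.le⟩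
    obtain ⟨hqC, hpq⟩ := Nat.find_spec hex
    have hmin : ∀ r ∈ C, p ≤ r → Nat.find hex ≤ r := fun r hr hpr => Nat.find_min' hex ⟨hr, hpr⟩
    have := hC.le_add_of_forall_le hmin
    exact ⟨_, ⟨hqC, p, hp, hpq, hmin⟩, by omega, by omega⟩

lemma localTo_alignTo (hC : IsCut C lo R) :
    LocalTo (· ∈ SeqCorr.alignTo C ρ) (fun i => (i ∈ C, i ∈ ρ)) := by
  have himp : ∀ i j, (∀ t ≤ 2 * R, (i + t ∈ C, i + t ∈ ρ) = (j + t ∈ C, j + t ∈ ρ)) →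
      R + i ∈ SeqCorr.alignTo C ρ → R + j ∈ SeqCorr.alignTo C ρ := by
    rintro i j hagree ⟨hiC, p, hp, hpi, hmin⟩
    have hagreeC : ∀ t ≤ 2 * R, (i + t ∈ C ↔ j + t ∈ C) := fun t ht =>
      (congrArg Prod.fst (hagree t ht)).to_iff
    have hagreeρ : ∀ t ≤ 2 * R, (i + t ∈ ρ ↔ j + t ∈ ρ) := fun t ht =>
      (congrArg Prod.snd (hagree t ht)).to_iff
    have hip := hC.le_add_of_forall_le hmin
    obtain ⟨s, rfl⟩ := Nat.exists_eq_add_of_le (show i ≤ p by omega)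
    rw [add_comm R] at hiC ⊢
    refine ⟨(hagreeC R (by omega)).1 hiC, j + s, (hagreeρ s (by omega)).1 hp, by omega,
      fun r hr hsr => ?_⟩
    by_contra! hrR
    obtain ⟨t, rfl⟩ := Nat.exists_eq_add_of_le (show j ≤ r by omega)
    have := hmin _ ((hagreeC t (by omega)).2 hr) (by omega)
    omega
  exact ⟨R, fun i j hagree =>
    propext ⟨himp i j hagree, himp j i fun t ht => (hagree t ht).symm⟩⟩

lemma exists_coarse {w : ℕ → B} (hC : IsCut C lo R) (hCw : FactorOf (· ∈ C) w)
    (hρ : IsCut ρ (L + R) (2 * (L + R))) (hρw : FactorOf (· ∈ ρ) w) (n : ℕ) :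
    ∃ C' ⊆ C, ∃ R', IsCut C' L R' ∧ FactorOf (· ∈ C') w ∧ ∃ n₀, n ≤ n₀ ∧ Consec C' 0 n₀ ∧
      ∀ i, n₀ ≤ i → ∃ q ∈ C', i < q ∧ q ≤ 2 * i := by
  have hcut := hC.alignTo hρ
  set G := 2 * L + 3 * R
  obtain ⟨n₀, hn₀, hlt, -⟩ := hcut.2.2 (G + n)
  refine ⟨{q | q ∈ SeqCorr.alignTo C ρ ∧ (q = 0 ∨ n₀ ≤ q)}, fun q hq => hq.1.1, n₀ + G,
    ⟨⟨hcut.1, Or.inl rfl⟩, fun p hp q hq => hcut.2.1 p hp.1 q hq.1, fun i => ?_⟩, ?_, n₀, by omega,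
    ⟨⟨hcut.1, Or.inl rfl⟩, ⟨hn₀, Or.inr le_rfl⟩, by omega, fun k hk hpos =>
      hk.2.resolve_left hpos.ne'⟩, fun i hi => ?_⟩
  · rcases lt_or_ge i n₀ with h | h
    · exact ⟨n₀, ⟨hn₀, Or.inr le_rfl⟩, h, by omega⟩
    · obtain ⟨q, hq, hiq, hqi⟩ := hcut.2.2 i
      exact ⟨q, ⟨hq, Or.inr (by omega)⟩, hiq, by omega⟩
  · exact (hC.localTo_alignTo.factorOf_trans (hCw.prodMk hρw)).congr (D := n₀) fun i =>
      propext (and_iff_left (Or.inr (by omega)))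
  · obtain ⟨q, hq, hiq, hqi⟩ := hcut.2.2 i
    exact ⟨q, ⟨hq, Or.inr (by omega)⟩, hiq, by omega⟩

lemma exists_replace {hi : ℕ} (hC : IsCut C lo hi) (y : ℕ → A) (f : List A → List A)
    (hf : ∀ p q, Consec C p q → (f (word y p (q - p))).length = q - p) :
    ∃ y' : ℕ → A, LocalTo y' (fun i => (y i, i ∈ C)) ∧
      ∀ p q, Consec C p q → word y' p (q - p) = f (word y p (q - p)) := by
  choose P Q hPQ hP hQ using hC.exists_consec
  refine ⟨fun i => ((f (word y (P i) (Q i - P i)))[i - P i]?).getD (y 0),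
    ⟨hi, fun i j hagree => ?_⟩, fun p q hpq => List.ext_getElem? fun t => ?_⟩
  · have hagreeC : ∀ t ≤ 2 * hi, (i + t ∈ C ↔ j + t ∈ C) := fun t ht =>
      (congrArg Prod.snd (hagree t ht)).to_iff
    have hagreey : ∀ t ≤ 2 * hi, y (i + t) = y (j + t) := fun t ht =>
      congrArg Prod.fst (hagree t ht)
    have hPi := hP (hi + i)
    have hQi := hQ (hi + i)
    have hlen := hC.consec_le (hPQ (hi + i))
    obtain ⟨s, hs⟩ := Nat.exists_eq_add_of_le (show i ≤ P (hi + i) by omega)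
    obtain ⟨r, hr⟩ := Nat.exists_eq_add_of_le (show i ≤ Q (hi + i) by omega)
    have hconsec := hPQ (hi + i)
    rw [hs, hr] at hconsec
    obtain ⟨hPj, hQj⟩ := (hconsec.add_of_agree hagreeC (by omega)).eq_of_mem (hPQ (hi + j))
      (i := hi + j) (by omega) (by omega) (hP _) (hQ _)
    have hword : word y (i + s) (r - s) = word y (j + s) (r - s) :=
      word_eq_word_iff.2 fun t ht => by
        simpa only [add_assoc] using hagreey (s + t) (by omega)
    simp only [hs, hr, ← hPj, ← hQj, Nat.add_sub_add_left, hword]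
    rw [show hi + i - (i + s) = hi + j - (j + s) by omega]
  · rcases lt_or_ge t (q - p) with ht | ht
    · obtain ⟨hp, hq⟩ := hpq.eq_of_mem (hPQ (p + t)) (by omega) (by omega) (hP _) (hQ _)
      rw [getElem?_word _ _ ht, ← hp, ← hq, Nat.add_sub_cancel_left,
        List.getElem?_eq_getElem (by rwa [hf p q hpq]), Option.getD_some]
    · rw [List.getElem?_eq_none (by simpa using ht),
        List.getElem?_eq_none (by rwa [hf p q hpq])]

lemma exists_nearest_blocks {hi : ℕ} (hC : IsCut C lo hi) (y : ℕ → A) {S : Set (List A)}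
    (hS : ∀ m, lo ≤ m → m ≤ hi → ∃ v ∈ S, v.length = m) :
    ∃ y' : ℕ → A, LocalTo y' (fun i => (y i, i ∈ C)) ∧
      (∀ p q, Consec C p q → word y' p (q - p) ∈ S) ∧
      ∀ p q, Consec C p q → ∀ v ∈ S, v.length = q - p →
        ∑ j ∈ range (q - p), ind (y (p + j) ≠ y' (p + j)) ≤ mismatch (word y p (q - p)) v := by
  have hnearest : ∀ u : List A, ∃ v, lo ≤ u.length → u.length ≤ hi → v ∈ S ∧
      v.length = u.length ∧ ∀ v' ∈ S, v'.length = u.length → mismatch u v ≤ mismatch u v' := by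
    intro u
    by_cases hu : lo ≤ u.length ∧ u.length ≤ hi
    · obtain ⟨v, hv⟩ := exists_nearest_word (hS _ hu.1 hu.2) u
      exact ⟨v, fun _ _ => hv⟩
    · exact ⟨[], fun hlo hhi => (hu ⟨hlo, hhi⟩).elim⟩
  choose f hf using hnearest
  have hblock : ∀ p q, Consec C p q → f (word y p (q - p)) ∈ S ∧
      (f (word y p (q - p))).length = q - p ∧ ∀ v ∈ S, v.length = q - p →
        mismatch (word y p (q - p)) (f (word y p (q - p))) ≤ mismatch (word y p (q - p)) v := by
    intro p q hpq
    have hlo := hC.le_consec hpq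
    have hhi := hC.consec_le hpq
    simpa only [length_word] using
      hf (word y p (q - p)) (by simp only [length_word]; omega) (by simp only [length_word]; omega)
  obtain ⟨y', hloc, hword⟩ := hC.exists_replace y f fun p q hpq => (hblock p q hpq).2.1
  refine ⟨y', hloc, fun p q hpq => hword p q hpq ▸ (hblock p q hpq).1, fun p q hpq v hv hlen => ?_⟩
  rw [← cast_mismatch_word, hword p q hpq]
  exact_mod_cast (hblock p q hpq).2.2 v hv hlen

end IsCut

section Refinement

open scoped Computability

lemma append_mem_kstar {𝒢 : Language A} {v₁ v₂ : List A} (h₁ : v₁ ∈ 𝒢∗) (h₂ : v₂ ∈ 𝒢∗) :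
    v₁ ++ v₂ ∈ 𝒢∗ := by
  rw [← kstar_mul_kstar]
  exact Language.append_mem_mul h₁ h₂

lemma exists_mem_kstar_length {𝒢 : Language A} {L : ℕ} (hL : 0 < L)
    (h : ∀ m, L ≤ m → m ≤ 2 * L → ∃ v ∈ 𝒢, v.length = m) {m : ℕ} (hm : L ≤ m) :
    ∃ v ∈ 𝒢∗, v.length = m := by
  induction m using Nat.strong_induction_on with
  | _ m ih =>
    rcases le_or_gt m (2 * L) with hle | hlt
    · exact (h m hm hle).imp fun v hv => ⟨le_kstar (a := 𝒢) hv.1, hv.2⟩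
    · obtain ⟨v₁, hv₁, hlen₁⟩ := ih (m - L) (by omega) (by omega)
      obtain ⟨v₂, hv₂, hlen₂⟩ := h L le_rfl (by omega)
      exact ⟨v₁ ++ v₂, append_mem_kstar hv₁ (le_kstar (a := 𝒢) hv₂), by
        rw [List.length_append]; omega⟩

/-- The cut set `C` divides `y` into blocks from `𝒢`, both `y` and `C` are factors of `w`, and
words from `𝒢` can be concatenated to words of all lengths from `s` on. -/
structure BlockStage (w : ℕ → B) (y : ℕ → A) (C : Set ℕ) (𝒢 : Language A) (R s : ℕ) : Prop where
  factor : FactorOf y w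
  cut_factor : FactorOf (· ∈ C) w
  cut : IsCut C 1 R
  block_mem : ∀ p q, Consec C p q → word y p (q - p) ∈ 𝒢
  exists_length : ∀ m, s ≤ m → ∃ v ∈ 𝒢∗, v.length = m

namespace BlockStage

variable {w : ℕ → B} {y : ℕ → A} {C : Set ℕ} {𝒢 : Language A} {R s : ℕ}

lemma word_mem (h : BlockStage w y C 𝒢 R s) {p q : ℕ} (hp : p ∈ C) (hq : q ∈ C) (hpq : p ≤ q) :
    word y p (q - p) ∈ 𝒢∗ := by
  refine h.cut.induction_on (P := fun q => word y p (q - p) ∈ 𝒢∗) hp hq hpq ?_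
    fun k r hpk hkr ih => ?_
  · rw [Nat.sub_self]
    exact Language.nil_mem_kstar _
  · rw [← word_append_word y hpk hkr.2.2.1.le]
    exact append_mem_kstar ih (le_kstar (a := 𝒢) (h.block_mem k r hkr))

lemma exists_mem_kstar_isInfix (h : BlockStage w y C 𝒢 R s) (m₀ : ℕ) :
    ∃ c, ∀ m, c ≤ m → ∃ v ∈ 𝒢∗, v.length = m ∧ word y 0 m₀ <:+: v := by
  obtain ⟨c₀, hc₀, hm₀, -⟩ := h.cut.2.2 m₀
  refine ⟨c₀ + s, fun m hm => ?_⟩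
  obtain ⟨v, hv, hlen⟩ := h.exists_length (m - c₀) (by omega)
  refine ⟨word y 0 c₀ ++ v, append_mem_kstar (h.word_mem h.cut.1 hc₀ c₀.zero_le) hv, ?_,
    ((word_prefix_word y 0 hm₀.le).trans (List.prefix_append _ _)).isInfix⟩
  rw [List.length_append, length_word, hlen]
  omega

end BlockStage

/-- A defect `D` of words which increases by at most `M` for each letter added in front, and which
along `y` is controlled by the sums of an error function `e`, up to a constant `X`. -/
structure ControlledDefect (D : List A → ℝ) (y : ℕ → A) (e : ℕ → ℝ) (M X : ℝ) : Prop where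
  nonneg : 0 ≤ M
  append_le : ∀ h t, D (h ++ t) ≤ D t + M * h.length
  error_nonneg : ∀ i, 0 ≤ e i
  word_le : ∀ p l, D (word y p l) ≤ ∑ j ∈ range l, e (p + j) + X

/-- The concatenations of words from `𝒢` of length between `lo` and `hi` which contain the word
`pre` and whose defect `D` is at most `δ` times their length. -/
def typicalWords (𝒢 : Language A) (D : List A → ℝ) (δ : ℝ) (lo hi : ℕ) (pre : List A) :
    Language A :=
  {v | v ∈ 𝒢∗ ∧ lo ≤ v.length ∧ v.length ≤ hi ∧ pre <:+: v ∧ D v ≤ δ * v.length}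

namespace BlockStage

variable {w : ℕ → B} {y : ℕ → A} {C : Set ℕ} {𝒢 : Language A} {R s : ℕ} {D : List A → ℝ}
  {e : ℕ → ℝ} {M X γ : ℝ} {pre : List A} {c L R' : ℕ}

/-- A stretch of `y` with small error is completed to a typical word by a short word in front. -/
lemma exists_append_mem_typicalWords (h : BlockStage w y C 𝒢 R s)
    (hD : ControlledDefect D y e M X)
    (hpre : ∀ m, c ≤ m → ∃ v ∈ 𝒢∗, v.length = m ∧ pre <:+: v) (hγ : 0 ≤ γ)
    (hL : X + M * (c + R : ℕ) ≤ γ * L) {d l k : ℕ} (hd : d ∈ C) (hdl : d + l ∈ C) (hck : c ≤ k)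
    (hkc : k ≤ c + R) (hlo : L ≤ k + l) (hhi : k + l ≤ R')
    (hsum : ∑ j ∈ range l, e (d + j) ≤ γ * (k + l : ℕ)) :
    ∃ v, v.length = k ∧ v ++ word y d l ∈ typicalWords 𝒢 D (2 * γ) L R' pre := by
  obtain ⟨v, hv, rfl, hsubword⟩ := hpre k hck
  have htail : word y d l ∈ 𝒢∗ := by
    simpa only [Nat.add_sub_cancel_left] using h.word_mem hd hdl (Nat.le_add_right d l)
  refine ⟨v, rfl, append_mem_kstar hv htail, ?_, ?_,
    hsubword.trans (List.prefix_append _ _).isInfix, ?_⟩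
  · rwa [List.length_append, length_word]
  · rwa [List.length_append, length_word]
  · have hMk : M * v.length ≤ M * (c + R : ℕ) := by have := hD.nonneg; gcongr
    have hγL : γ * L ≤ γ * (v.length + l : ℕ) := by gcongr
    rw [List.length_append, length_word]
    linarith [hD.append_le v (word y d l), hD.word_le d l]

lemma exists_mem_typicalWords_length (h : BlockStage w y C 𝒢 R s)
    (hD : ControlledDefect D y e M X)
    (hpre : ∀ m, c ≤ m → ∃ v ∈ 𝒢∗, v.length = m ∧ pre <:+: v) (hγ : 0 ≤ γ)
    (hL : X + M * (c + R : ℕ) ≤ γ * L) {n₁ : ℕ}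
    (hmean : ∀ n, n₁ ≤ n → ∑ i ∈ range n, e i ≤ γ * n) (hn₁ : n₁ + c + R < L) {m : ℕ}
    (hLm : L ≤ m) (hmR : m ≤ R') :
    ∃ v ∈ typicalWords 𝒢 D (2 * γ) L R' pre, v.length = m := by
  obtain ⟨q, hq, hlt, hle⟩ := h.cut.2.2 (m - (c + R) - 1)
  have hsum : ∑ j ∈ range q, e (0 + j) ≤ γ * (m - q + q : ℕ) := by
    simp only [zero_add]
    exact (hmean q (by omega)).trans (by gcongr; omega)
  obtain ⟨v, hlen, hv⟩ := h.exists_append_mem_typicalWords hD hpre hγ hL h.cut.1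
    (by rwa [zero_add]) (R' := R') (k := m - q) (by omega) (by omega) (by omega) (by omega) hsum
  exact ⟨_, hv, by rw [List.length_append, length_word]; omega⟩

lemma le_sum_of_le_mismatch (h : BlockStage w y C 𝒢 R s)
    (hD : ControlledDefect D y e M X)
    (hpre : ∀ m, c ≤ m → ∃ v ∈ 𝒢∗, v.length = m ∧ pre <:+: v) (hγ : 0 < γ)
    (hL : X + M * (c + R : ℕ) ≤ γ * L) {α : ℝ} (hα : 0 ≤ α) (hLα : (c + R : ℕ) ≤ α * L)
    {p l : ℕ} (hpl : p + l ∈ C) (hlo : L ≤ l) (hhi : l ≤ R') (hcL : c + R < L)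
    (hex : ∃ v ∈ typicalWords 𝒢 D (2 * γ) L R' pre, v.length = l) {b : ℝ}
    (hb : ∀ v ∈ typicalWords 𝒢 D (2 * γ) L R' pre, v.length = l →
      b ≤ mismatch (word y p l) v) :
    b ≤ ∑ j ∈ range l, (α + e (p + j) / γ) := by
  have herror : 0 ≤ ∑ j ∈ range l, e (p + j) := Finset.sum_nonneg fun _ _ => hD.error_nonneg _
  rw [Finset.sum_add_distrib, Finset.sum_const, Finset.card_range, nsmul_eq_mul,
    ← Finset.sum_div]
  by_cases hsmall : ∑ j ∈ range l, e (p + j) ≤ γ * l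
  · obtain ⟨d, hd, hlt, hle⟩ := h.cut.2.2 (p + c)
    obtain ⟨k, rfl⟩ := Nat.exists_eq_add_of_le (show p ≤ d by omega)
    obtain ⟨t, rfl⟩ := Nat.exists_eq_add_of_le (show k ≤ l by omega)
    have htail : ∑ j ∈ range t, e (p + k + j) ≤ γ * (k + t : ℕ) := by
      refine le_trans ?_ hsmall
      rw [Finset.sum_range_add]
      simp only [add_assoc]
      exact le_add_of_nonneg_left (Finset.sum_nonneg fun _ _ => hD.error_nonneg _)
    obtain ⟨v, hlen, hv⟩ := h.exists_append_mem_typicalWords hD hpre hγ.le hL hd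
      (by rwa [add_assoc]) (by omega) (by omega) hlo hhi htail
    have hmis := mismatch_append_le (u := word y p k) (v := v) (word y (p + k) t) (by simpa)
    rw [← word_add, length_word] at hmis
    calc b ≤ mismatch (word y p (k + t)) (v ++ word y (p + k) t) := hb _ hv (by simp [hlen])
      _ ≤ (c + R : ℕ) := by exact_mod_cast hmis.trans (by omega)
      _ ≤ α * L := hLα
      _ ≤ (k + t : ℕ) * α := by rw [mul_comm]; gcongr
      _ ≤ _ := le_add_of_nonneg_right (by positivity)
  · obtain ⟨v, hv, hlen⟩ := hex
    calc b ≤ mismatch (word y p l) v := hb v hv hlen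
      _ ≤ l := by simpa using mismatch_le_length (word y p l) v
      _ ≤ (∑ j ∈ range l, e (p + j)) / γ := by
        rw [le_div_iff₀ hγ, mul_comm]; exact (not_le.1 hsmall).le
      _ ≤ _ := le_add_of_nonneg_left (by positivity)

lemma word_zero_mem_typicalWords (h : BlockStage w y C 𝒢 R s)
    (hD : ControlledDefect D y e M X) (hγ : 0 ≤ γ) (hL : X ≤ γ * L) {n m₀ : ℕ} (hn : n ∈ C)
    (hmean : ∑ i ∈ range n, e i ≤ γ * n) (hm₀ : m₀ ≤ n) (hlo : L ≤ n) (hhi : n ≤ R') :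
    word y 0 n ∈ typicalWords 𝒢 D (2 * γ) L R' (word y 0 m₀) := by
  refine ⟨h.word_mem h.cut.1 hn n.zero_le, ?_, ?_, (word_prefix_word y 0 hm₀).isInfix, ?_⟩
  · rwa [length_word]
  · rwa [length_word]
  · have hdefect := hD.word_le 0 n
    have hγL : γ * L ≤ γ * n := by gcongr
    simp only [zero_add] at hdefect
    rw [length_word]
    linarith

end BlockStage

lemma sum_range_le_of_cut_points {f : ℕ → ℝ} (hf : ∀ i, 0 ≤ f i) {C : Set ℕ} {n₀ : ℕ} {ε : ℝ}
    (hε : 0 ≤ ε) (hzero : ∀ i < n₀, f i = 0) (hC : ∀ i, n₀ ≤ i → ∃ q ∈ C, i < q ∧ q ≤ 2 * i)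
    (hcut : ∀ q ∈ C, n₀ ≤ q → ∑ i ∈ range q, f i ≤ ε / 2 * q) (n : ℕ) :
    ∑ i ∈ range n, f i ≤ ε * n := by
  rcases lt_or_ge n n₀ with hn | hn
  · rw [Finset.sum_eq_zero fun i hi => hzero i ((Finset.mem_range.1 hi).trans hn)]
    positivity
  · obtain ⟨q, hq, hnq, hqn⟩ := hC n hn
    have hqn' : (q : ℝ) ≤ 2 * n := by exact_mod_cast hqn
    calc ∑ i ∈ range n, f i ≤ ∑ i ∈ range q, f i :=
          Finset.sum_le_sum_of_subset_of_nonneg (Finset.range_subset_range.2 hnq.le)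
            fun i _ _ => hf i
      _ ≤ ε / 2 * q := hcut q hq (hn.trans hnq.le)
      _ ≤ ε / 2 * (2 * n) := by gcongr
      _ = ε * n := by ring

/-- The sequence `y'` differs from `y` on a set of density at most `ε` and not before `m₀`, and
the blocks in `𝒢'`, concatenations of blocks from `𝒢`, are long but bounded, contain the first
`m₀` letters of `y`, and have nearly constant frequencies of the words in `U`. -/
structure IsRefinement (U : Finset (List A)) (δ ε : ℝ) (m₀ : ℕ) (y : ℕ → A) (𝒢 : Language A)
    (y' : ℕ → A) (𝒢' : Language A) : Prop where
  eq_of_lt : ∀ i < m₀, y i = y' i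
  sum_ne_le : ∀ n : ℕ, ∑ i ∈ range n, ind (y i ≠ y' i) ≤ ε * n
  le_kstar : 𝒢' ≤ (𝒢∗)
  le_length : ∀ v ∈ 𝒢', m₀ ≤ v.length
  exists_length_le : ∃ R, ∀ v ∈ 𝒢', v.length ≤ R
  word_isInfix : ∀ v ∈ 𝒢', word y 0 m₀ <:+: v
  exists_discrepancy_le : ∃ c, ∀ v ∈ 𝒢', discrepancy U c v ≤ δ * v.length

/-- Replacing the blocks between sparse cut points by nearest typical words changes `y` rarely,
since blocks with small error only need a new short beginning. -/
lemma BlockStage.exists_typical_blocks {w : ℕ → B} {y : ℕ → A} {C C' : Set ℕ} {𝒢 : Language A}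
    {R s : ℕ} {D : List A → ℝ} {e : ℕ → ℝ} {M X γ ε : ℝ} {c L R' n₀ n₁ m₀ : ℕ}
    (h : BlockStage w y C 𝒢 R s) (hD : ControlledDefect D y e M X)
    (hpre : ∀ m, c ≤ m → ∃ v ∈ 𝒢∗, v.length = m ∧ word y 0 m₀ <:+: v) (hγ : 0 < γ) (hε : 0 < ε)
    (hL : X + M * (c + R : ℕ) ≤ γ * L) (hLε : (c + R : ℕ) ≤ ε / 4 * L)
    (hLn : n₁ + c + R + m₀ < L)
    (hmean : ∀ n, n₁ ≤ n → ∑ i ∈ range n, e i ≤ γ * min (ε / 4) 1 * n)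
    (hcut : IsCut C' L R') (hC' : C' ⊆ C) (hfirst : Consec C' 0 n₀)
    (hdense : ∀ i, n₀ ≤ i → ∃ q ∈ C', i < q ∧ q ≤ 2 * i)
    (hlength : ∀ m, L ≤ m → m ≤ R' →
      ∃ v ∈ typicalWords 𝒢 D (2 * γ) L R' (word y 0 m₀), v.length = m) :
    ∃ y', LocalTo y' (fun i => (y i, i ∈ C')) ∧
      (∀ p q, Consec C' p q →
        word y' p (q - p) ∈ typicalWords 𝒢 D (2 * γ) L R' (word y 0 m₀)) ∧
      (∀ i < n₀, y i = y' i) ∧ ∀ n : ℕ, ∑ i ∈ range n, ind (y i ≠ y' i) ≤ ε * n := by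
  obtain ⟨y', hloc, hblock, hnear⟩ := hcut.exists_nearest_blocks y hlength
  have hLn₀ := hcut.le_consec hfirst
  have hmeanγ : ∑ i ∈ range n₀, e i ≤ γ * n₀ := (hmean n₀ (by omega)).trans
    (by gcongr; exact mul_le_of_le_one_right hγ.le (min_le_right _ _))
  have hM := hD.nonneg
  have htypical : word y 0 n₀ ∈ typicalWords 𝒢 D (2 * γ) L R' (word y 0 m₀) :=
    h.word_zero_mem_typicalWords hD hγ.le (by linarith [show 0 ≤ M * (c + R : ℕ) by positivity])
      (hC' hfirst.2.1) hmeanγ (by omega) (by omega) (by simpa using hcut.consec_le hfirst)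
  have hagree : ∀ i < n₀, y i = y' i := by
    have hzero := hnear 0 n₀ hfirst _ htypical (by simp)
    rw [Nat.sub_zero, mismatch_self, Nat.cast_zero] at hzero
    simpa only [zero_add, not_not] using fun i => not_of_sum_ind_le_zero hzero (i := i)
  refine ⟨y', hloc, hblock, hagree, sum_range_le_of_cut_points (fun _ => ind_nonneg _) hε.le
    (fun i hi => ind_of_not (not_not.2 (hagree i hi))) hdense fun q hq hn₀q => ?_⟩
  have hchange := hcut.sum_range_le (f := fun i => ind (y i ≠ y' i))
    (g := fun i => ε / 4 + e i / γ) (fun p r hpr => ?_) hq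
  · have he := hmean q (by omega)
    have hsum : ∑ i ∈ range q, (ε / 4 + e i / γ) = q * (ε / 4) + (∑ i ∈ range q, e i) / γ := by
      simp [Finset.sum_add_distrib, Finset.sum_div]
    have hediv : (∑ i ∈ range q, e i) / γ ≤ ε / 4 * q := by
      rw [div_le_iff₀' hγ, ← mul_assoc]
      exact he.trans (by gcongr; exact min_le_left _ _)
    linarith
  · obtain ⟨l, rfl⟩ := Nat.exists_eq_add_of_le hpr.2.2.1.le
    have hlo := hcut.le_consec hpr
    have hhi := hcut.consec_le hpr
    have hb := hnear p (p + l) hpr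
    rw [Nat.add_sub_cancel_left] at hb ⊢
    exact h.le_sum_of_le_mismatch hD hpre hγ hL (by positivity) hLε (hC' hpr.2.1) (by omega)
      (by omega) (by omega) (hlength l (by omega) (by omega)) hb

theorem BlockStage.exists_isRefinement {w : ℕ → B} {y : ℕ → A} {C : Set ℕ} {𝒢 : Language A}
    {R s : ℕ} (h : BlockStage w y C 𝒢 R s) (hw : ErgSeq w)
    (hmark : ∀ L, 0 < L → ∃ ρ : Set ℕ, IsCut ρ L (2 * L) ∧ FactorOf (· ∈ ρ) w)
    (U : Finset (List A)) {δ ε : ℝ} (hδ : 0 < δ) (hε : 0 < ε) (m₀ : ℕ) :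
    ∃ y' 𝒢', (∃ C' R' s', BlockStage w y' C' 𝒢' R' s') ∧ IsRefinement U δ ε m₀ y 𝒢 y' 𝒢' := by
  obtain ⟨c, hc⟩ := h.factor.exists_discrepancy_word_le hw U
  obtain ⟨e, X, he₀, hmean, hword⟩ := hc (δ / 2 * min (ε / 4) 1) (by positivity)
  obtain ⟨n₁, hn₁⟩ := eventually_atTop.1 hmean
  obtain ⟨k, hk⟩ := h.exists_mem_kstar_isInfix m₀
  have hM : 0 ≤ ∑ u ∈ U, (1 + |c u|) := by positivity
  have hD : ControlledDefect (discrepancy U c) y e (∑ u ∈ U, (1 + |c u|)) X :=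
    ⟨hM, discrepancy_append_le U c, he₀, hword⟩
  obtain ⟨L, ⟨hL, hLε⟩, hLn⟩ := (((eventually_const_le (half_pos hδ)
    (X + (∑ u ∈ U, (1 + |c u|)) * (k + R : ℕ))).and (eventually_const_le
    (show 0 < ε / 4 by positivity) (k + R : ℕ))).and (eventually_gt_atTop (n₁ + k + R + m₀))).exists
  have hmean' : ∀ n, n₁ ≤ n → ∑ i ∈ range n, e i ≤ δ / 2 * n := fun n hn =>
    (hn₁ n hn).trans (by gcongr; exact mul_le_of_le_one_right (by positivity) (min_le_right _ _))
  obtain ⟨ρ, hρ, hρw⟩ := hmark (L + R) (by omega)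
  obtain ⟨C', hC'C, R', hcut, hC'w, n₀, hn₀, hfirst, hdense⟩ :=
    h.cut.exists_coarse h.cut_factor hρ hρw (2 * L)
  have hlength : ∀ m, L ≤ m → m ≤ R' →
      ∃ v ∈ typicalWords 𝒢 (discrepancy U c) (2 * (δ / 2)) L R' (word y 0 m₀), v.length = m :=
    fun m => h.exists_mem_typicalWords_length hD hk (half_pos hδ).le hL hmean' (by omega)
  obtain ⟨y', hloc, hblock, hagree, hchange⟩ := h.exists_typical_blocks hD hk (half_pos hδ) hε hL
    hLε hLn hn₁ hcut hC'C hfirst hdense hlength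
  refine ⟨y', _, ⟨C', R', L, hloc.factorOf_trans (h.factor.prodMk hC'w), hC'w,
    ⟨hcut.1, fun _ _ _ _ hpq => hpq, hcut.2.2⟩, hblock, fun m => exists_mem_kstar_length
      (by omega) fun m hLm hm => hlength m hLm (by have := hcut.consec_le hfirst; omega)⟩,
    fun i hi => hagree i (by omega), hchange, fun v hv => hv.1,
    fun v hv => le_trans (by omega) hv.2.1, ⟨R', fun v hv => hv.2.2.1⟩, fun v hv => hv.2.2.2.1,
    c, fun v hv => hv.2.2.2.2.trans_eq (by ring)⟩

end Refinement

/-! ### Uniform limits -/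

section Uniform

open scoped Computability

/-- Every word has a uniform frequency in `z`. -/
def UniformFreq (z : ℕ → A) : Prop :=
  ∀ u : List A, ∀ δ > 0, ∃ c : ℝ, ∃ l₀ : ℕ, ∀ l, l₀ ≤ l → ∀ i,
    |∑ j ∈ range l, ind (word z (i + j) u.length = u) - c * l| ≤ δ * l

/-- Every initial word of `z` recurs with bounded gaps. -/
def UniformRec (z : ℕ → A) : Prop :=
  ∀ m, ∃ R : ℕ, ∀ i, ∃ j ≤ R, word z (i + j) m = word z 0 m

lemma exists_split_of_mem_kstar {𝒢 : Language A} {R : ℕ} (h𝒢 : ∀ v ∈ 𝒢, v.length ≤ R) {v : List A}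
    (hv : v ∈ 𝒢∗) {t : ℕ} (ht : t ≤ v.length) :
    ∃ v₁ ∈ 𝒢∗, ∃ v₂ ∈ 𝒢∗, v = v₁ ++ v₂ ∧ t ≤ v₁.length ∧ v₁.length ≤ t + R := by
  obtain ⟨vs, rfl, hvs⟩ := Language.mem_kstar.1 hv
  clear hv
  induction vs generalizing t with
  | nil => exact ⟨[], Language.nil_mem_kstar _, [], Language.nil_mem_kstar _, rfl, ht, by simp⟩
  | cons b vs ih =>
    have hb : b ∈ 𝒢 := hvs b List.mem_cons_self
    have hvs' : ∀ v ∈ vs, v ∈ 𝒢 := fun v hv => hvs v (List.mem_cons_of_mem b hv)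
    rw [List.flatten_cons] at ht ⊢
    rcases le_total t b.length with h | h
    · exact ⟨b, le_kstar (a := 𝒢) hb, vs.flatten, Language.join_mem_kstar hvs', rfl, h,
        (h𝒢 b hb).trans (Nat.le_add_left _ _)⟩
    · rw [List.length_append] at ht
      obtain ⟨v₁, hv₁, v₂, hv₂, hsplit, hlo, hhi⟩ := ih hvs' (t := t - b.length) (by omega)
      refine ⟨b ++ v₁, append_mem_kstar (le_kstar (a := 𝒢) hb) hv₁, v₂, hv₂, ?_, ?_, ?_⟩
      · rw [hsplit, List.append_assoc]
      · rw [List.length_append]; omega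
      · rw [List.length_append]; omega

lemma exists_infix_of_mem_kstar {𝒢 : Language A} {v : List A} (hv : v ∈ 𝒢∗) (hne : v ≠ []) :
    ∃ b ∈ 𝒢, b <:+: v := by
  obtain ⟨vs, rfl, hvs⟩ := Language.mem_kstar.1 hv
  obtain ⟨b, hb⟩ := List.exists_mem_of_ne_nil vs (by rintro rfl; exact hne rfl)
  exact ⟨b, hvs b hb, List.infix_of_mem_flatten hb⟩

lemma abs_occ_sub_le_of_mem_kstar {𝒢 : Language A} {u : List A} {c δ κ : ℝ}
    (hfreq : ∀ v ∈ 𝒢, |occ u v - c * v.length| ≤ δ * v.length)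
    (hlen : ∀ v ∈ 𝒢, u.length ≤ κ * v.length) {v : List A} (hv : v ∈ 𝒢∗) :
    |occ u v - c * v.length| ≤ (δ + κ) * v.length := by
  obtain ⟨vs, rfl, hvs⟩ := Language.mem_kstar.1 hv
  clear hv
  induction vs with
  | nil => simp [occ]
  | cons b vs ih =>
    have hflat := abs_le.1 (ih fun v hv => hvs v (List.mem_cons_of_mem b hv))
    have hb := abs_le.1 (hfreq b (hvs b List.mem_cons_self))
    have hub := hlen b (hvs b List.mem_cons_self)
    have hlo := occ_add_occ_le u b vs.flatten
    have hhi := occ_append_le u b vs.flatten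
    rw [List.flatten_cons, List.length_append, abs_le]
    push_cast
    constructor <;> linarith

/-- Every long window of `z` is a concatenation of blocks from `𝒢`, up to at most `R` letters at
both ends. -/
def CoveredBy (𝒢 : Language A) (R : ℕ) (z : ℕ → A) : Prop :=
  ∀ i l, 2 * R ≤ l → ∃ a l', i ≤ a ∧ a + l' ≤ i + l ∧ l ≤ l' + 2 * R ∧ word z a l' ∈ 𝒢∗

lemma exists_word_mem_kstar {𝒢 : Language A} {R : ℕ} (h𝒢 : ∀ v ∈ 𝒢, v.length ≤ R) {z : ℕ → A}
    {n i l : ℕ} (hz : word z 0 n ∈ 𝒢∗) (hn : i + l ≤ n) (hl : 2 * R ≤ l) :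
    ∃ a l', i ≤ a ∧ a + l' ≤ i + l ∧ l ≤ l' + 2 * R ∧ word z a l' ∈ 𝒢∗ := by
  obtain ⟨v₁, -, v₂, hv₂, hsplit, hlo, hhi⟩ :=
    exists_split_of_mem_kstar h𝒢 hz (t := i) (by rw [length_word]; omega)
  have hlen := congrArg List.length hsplit
  rw [length_word, List.length_append] at hlen
  obtain ⟨v₃, hv₃, v₄, -, rfl, hlo', hhi'⟩ :=
    exists_split_of_mem_kstar h𝒢 hv₂ (t := i + l - R - v₁.length) (by omega)
  have hword := (eq_word_of_word_eq_append (eq_word_of_word_eq_append hsplit).2).1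
  rw [zero_add] at hword
  exact ⟨v₁.length, v₃.length, hlo, by omega, by omega, by rwa [hword]⟩

lemma abs_sum_ind_sub_sum_ind_le (P : ℕ → Prop) {i a l l' : ℕ} (hia : i ≤ a)
    (hal : a + l' ≤ i + l) :
    |∑ j ∈ range l, ind (P (i + j)) - ∑ j ∈ range l', ind (P (a + j))| ≤ l - l' := by
  obtain ⟨x, rfl⟩ := Nat.exists_eq_add_of_le hia
  obtain ⟨t, rfl⟩ := Nat.exists_eq_add_of_le (show x + l' ≤ l by omega)
  rw [Finset.sum_range_add, Finset.sum_range_add]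
  simp only [← add_assoc]
  have hx₀ := sum_ind_nonneg (fun j => P (i + j)) x
  have hx₁ := sum_ind_le (fun j => P (i + j)) x
  have ht₀ := sum_ind_nonneg (fun j => P (i + x + l' + j)) t
  have ht₁ := sum_ind_le (fun j => P (i + x + l' + j)) t
  rw [abs_le]
  push_cast
  constructor <;> linarith

namespace CoveredBy

variable {𝒢 : Language A} {R : ℕ} {z : ℕ → A}

lemma abs_sum_sub_le (hz : CoveredBy 𝒢 R z) {u : List A} {c δ κ : ℝ}
    (hfreq : ∀ v ∈ 𝒢, |occ u v - c * v.length| ≤ δ * v.length)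
    (hlen : ∀ v ∈ 𝒢, u.length ≤ κ * v.length) (hδκ : 0 ≤ δ + κ) (i : ℕ) {l : ℕ}
    (hl : 2 * R ≤ l) :
    |∑ j ∈ range l, ind (word z (i + j) u.length = u) - c * l|
      ≤ (δ + κ) * l + (u.length + (1 + |c|) * (2 * R)) := by
  obtain ⟨a, l', hia, hal, hll, hmem⟩ := hz i l hl
  have hends := abs_le.1
    (abs_sum_ind_sub_sum_ind_le (fun j => word z j u.length = u) hia hal)
  have hoccsum := abs_le.1 (abs_occ_word_sub_sum_le z u a l')
  have hocc := abs_occ_sub_le_of_mem_kstar hfreq hlen hmem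
  rw [length_word, abs_le] at hocc
  have hlR : (l : ℝ) - l' ≤ 2 * R := by
    rw [sub_le_iff_le_add']; exact_mod_cast hll
  have hl'l : (l' : ℝ) ≤ l := by exact_mod_cast (by omega : l' ≤ l)
  have hδl : (δ + κ) * l' ≤ (δ + κ) * l := by gcongr
  have hc : |c * (l - l')| ≤ |c| * (2 * R) := by
    rw [abs_mul, abs_of_nonneg (sub_nonneg.2 hl'l)]
    gcongr
  rw [abs_le] at hc ⊢
  constructor <;> linarith

lemma exists_word_eq (hz : CoveredBy 𝒢 R z) {u : List A} (hu : ∀ v ∈ 𝒢, u <:+: v) (i : ℕ) :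
    ∃ j ≤ 2 * R + 1, word z (i + j) u.length = u := by
  obtain ⟨a, l', hia, hal, hll, hmem⟩ := hz i (2 * R + 1) (by omega)
  obtain ⟨b, hb, hsubword⟩ := exists_infix_of_mem_kstar hmem
    (List.ne_nil_of_length_pos (by rw [length_word]; omega))
  obtain ⟨j, hj, hword⟩ := exists_word_eq_of_isInfix ((hu b hb).trans hsubword)
  exact ⟨a - i + j, by omega, by rwa [show i + (a - i + j) = a + j by omega]⟩

end CoveredBy

lemma exists_nat_seq {α : Type*} {P : α → Prop} {r : ℕ → α → α → Prop} {a : α} (ha : P a)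
    (hnext : ∀ k b, P b → ∃ b', P b' ∧ r k b b') :
    ∃ f : ℕ → α, f 0 = a ∧ ∀ k, P (f k) ∧ r k (f k) (f (k + 1)) := by
  choose! g hg using hnext
  let f : ℕ → α := fun k => Nat.rec a g k
  have hf : ∀ k, P (f k) := fun k => Nat.rec ha (fun k ih => (hg k _ ih).1) k
  exact ⟨f, rfl, fun k => ⟨hf k, (hg k _ (hf k)).2⟩⟩

lemma blockStage_univ {w : ℕ → B} {y : ℕ → A} (hy : FactorOf y w) :
    BlockStage w y Set.univ {v | v.length = 1} 1 0 where
  factor := hy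
  cut_factor := LocalTo.factorOf_trans ⟨0, fun _ _ _ => rfl⟩ hy
  cut := ⟨Set.mem_univ _, fun _ _ _ _ h => h, fun i => ⟨i + 1, Set.mem_univ _, by omega, le_rfl⟩⟩
  block_mem p q hpq := by
    have hle := hpq.2.2.2 (p + 1) (Set.mem_univ _) (by omega)
    have hlt := hpq.2.2.1
    change (word y p (q - p)).length = 1
    rw [length_word]
    omega
  exists_length m _ := by
    refine ⟨(List.replicate m [y 0]).flatten, Language.join_mem_kstar fun v hv => ?_, by simp⟩
    rw [List.eq_of_mem_replicate hv]
    rfl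

section Limit

variable {Y : ℕ → ℕ → A}

lemma eq_of_le_of_forall_eq_succ (h : ∀ k, ∀ i ≤ k, Y k i = Y (k + 1) i) {i j : ℕ} (hij : i ≤ j) :
    Y i i = Y j i := by
  induction j, hij using Nat.le_induction with
  | base => rfl
  | succ j hij ih => rw [ih, h j i hij]

lemma sum_ind_ne_le_sum {η : ℕ → ℝ} {n : ℕ}
    (h : ∀ k, ∑ i ∈ range n, ind (Y k i ≠ Y (k + 1) i) ≤ η k) (K : ℕ) :
    ∑ i ∈ range n, ind (Y 0 i ≠ Y K i) ≤ ∑ k ∈ range K, η k := by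
  induction K with
  | zero => simp [ind]
  | succ K ih =>
    rw [Finset.sum_range_succ]
    refine le_trans ?_ (add_le_add ih (h K))
    rw [← Finset.sum_add_distrib]
    exact Finset.sum_le_sum fun i _ => ind_ne_le_ind_ne_add_ind_ne _ _ _

end Limit

/-- Successive refinements `(Y k, 𝒢 k)` of a sequence and its language of blocks, with errors
`1 / (k + 1)` for the frequencies of all words of length at most `k`, and summable changes. Every
`Y k` is a concatenation of blocks from `𝒢 k`. -/
structure IsRefinementChain [Finite A] (ε : ℝ) (Y : ℕ → ℕ → A) (𝒢 : ℕ → Language A) : Prop where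
  exists_word_mem : ∀ k n, ∃ q, n ≤ q ∧ word (Y k) 0 q ∈ ((𝒢 k)∗)
  refinement : ∀ k, IsRefinement (List.finite_length_le A k).toFinset (1 / (k + 1))
    (ε * (1 / 2) ^ (k + 1)) ((k + 1) ^ 2) (Y k) (𝒢 k) (Y (k + 1)) (𝒢 (k + 1))

lemma ErgSeq.exists_isRefinementChain [Finite A] {y : ℕ → A} (hy : ErgSeq y) {ε : ℝ} (hε : 0 < ε) :
    ∃ Y 𝒢, Y 0 = y ∧ IsRefinementChain ε Y 𝒢 := by
  obtain ⟨b, hw, hnormal⟩ := hy.exists_relatively_normal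
  have hfst : LocalTo y fun i => (y i, b i) :=
    (LocalTo.refl fun i => (y i, b i)).comp Prod.fst
  have hsnd : LocalTo b fun i => (y i, b i) :=
    (LocalTo.refl fun i => (y i, b i)).comp Prod.snd
  have hmark : ∀ L, 0 < L → ∃ ρ, IsCut ρ L (2 * L) ∧ FactorOf (· ∈ ρ) fun i => (y i, b i) :=
    fun L hL => by
      obtain ⟨ρ, hcut, hρ⟩ := exists_isCut_factorOf hnormal hL
      exact ⟨ρ, hcut, hρ.trans_localTo hsnd⟩
  obtain ⟨f, hf₀, hf⟩ := exists_nat_seq (a := (y, {v | v.length = 1}))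
    (P := fun t : (ℕ → A) × Language A => ∃ C R s, BlockStage (fun i => (y i, b i)) t.1 C t.2 R s)
    (r := fun k t t' => IsRefinement (List.finite_length_le A k).toFinset (1 / (k + 1))
      (ε * (1 / 2) ^ (k + 1)) ((k + 1) ^ 2) t.1 t.2 t'.1 t'.2)
    ⟨_, _, _, blockStage_univ hfst.factorOf⟩ fun k _ ⟨_, _, _, hstage⟩ => by
      obtain ⟨y', 𝒢', hstage', href⟩ := hstage.exists_isRefinement hw hmark
        (List.finite_length_le A k).toFinset (δ := 1 / (k + 1)) (ε := ε * (1 / 2) ^ (k + 1))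
        (by positivity) (by positivity) ((k + 1) ^ 2)
      exact ⟨(y', 𝒢'), hstage', href⟩
  refine ⟨fun k => (f k).1, fun k => (f k).2, congrArg Prod.fst hf₀, fun k n => ?_,
    fun k => (hf k).2⟩
  obtain ⟨C, R, s, hstage⟩ := (hf k).1
  obtain ⟨q, hqC, hq, -⟩ := hstage.cut.2.2 n
  exact ⟨q, hq.le, hstage.word_mem hstage.cut.1 hqC (Nat.zero_le q)⟩

namespace IsRefinementChain

variable [Finite A] {ε : ℝ} {Y : ℕ → ℕ → A} {𝒢 : ℕ → Language A}

lemma diag_eq (h : IsRefinementChain ε Y 𝒢) {i j : ℕ} (hij : i ≤ j) : Y i i = Y j i :=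
  eq_of_le_of_forall_eq_succ (fun k i hi => (h.refinement k).eq_of_lt i (by nlinarith)) hij

lemma word_diag (h : IsRefinementChain ε Y 𝒢) {p n k : ℕ} (hk : p + n ≤ k) :
    word (fun i => Y i i) p n = word (Y k) p n :=
  word_eq_word_iff.2 fun t ht => h.diag_eq (by omega)

lemma coveredBy_diag (h : IsRefinementChain ε Y 𝒢) {k R : ℕ} (hR : ∀ v ∈ 𝒢 k, v.length ≤ R) :
    CoveredBy (𝒢 k) R fun i => Y i i := by
  intro i l hl
  have hanti : Antitone fun k => ((𝒢 k)∗) := antitone_nat_of_succ_le fun k =>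
    (kstar_mono (h.refinement k).le_kstar).trans_eq (kstar_idem (𝒢 k))
  obtain ⟨q, hq, hword⟩ := h.exists_word_mem (max k (i + l)) (i + l)
  obtain ⟨a, l', hia, hal, hll, hmem⟩ :=
    exists_word_mem_kstar hR (hanti (le_max_left k (i + l)) hword) hq hl
  refine ⟨a, l', hia, hal, hll, ?_⟩
  rwa [h.word_diag (hal.trans (le_max_right k _))]

lemma exists_abs_occ_sub_le (h : IsRefinementChain ε Y 𝒢) {k : ℕ} {u : List A}
    (hu : u.length ≤ k) :
    ∃ c : ℝ, ∀ v ∈ 𝒢 (k + 1), |occ u v - c * v.length| ≤ 1 / (k + 1) * v.length := by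
  obtain ⟨c, hc⟩ := (h.refinement k).exists_discrepancy_le
  exact ⟨c u, fun v hv => le_trans (Finset.single_le_sum
    (f := fun u => |occ u v - c u * v.length|) (fun _ _ => abs_nonneg _) (by simpa using hu))
    (hc v hv)⟩

lemma length_le_mul (h : IsRefinementChain ε Y 𝒢) {k : ℕ} {u : List A} (hu : u.length ≤ k)
    {v : List A} (hv : v ∈ 𝒢 (k + 1)) : (u.length : ℝ) ≤ 1 / (k + 1) * v.length := by
  have hlen : ((k + 1) ^ 2 : ℝ) ≤ v.length := by
    exact_mod_cast (h.refinement k).le_length v hv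
  have hk : (u.length : ℝ) ≤ k := by exact_mod_cast hu
  rw [one_div, inv_mul_eq_div, le_div_iff₀ (by positivity)]
  nlinarith

lemma uniformFreq_diag (h : IsRefinementChain ε Y 𝒢) : UniformFreq fun i => Y i i := by
  intro u δ hδ
  obtain ⟨k, hkδ, hku⟩ := ((eventually_const_le hδ 3).and (eventually_ge_atTop u.length)).exists
  obtain ⟨c, hc⟩ := h.exists_abs_occ_sub_le hku
  obtain ⟨R, hR⟩ := (h.refinement k).exists_length_le
  obtain ⟨l₀, hl₀⟩ := eventually_atTop.1 (eventually_const_le (ε := 1 / (k + 1)) (by positivity)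
    (u.length + (1 + |c|) * (2 * R)))
  have hδk : 3 * (1 / (k + 1) : ℝ) ≤ δ := by
    rw [mul_one_div, div_le_iff₀ (by positivity)]
    linarith
  refine ⟨c, max l₀ (2 * R), fun l hl i => ?_⟩
  calc _ ≤ (1 / (k + 1) + 1 / (k + 1)) * l + (u.length + (1 + |c|) * (2 * R)) :=
        (h.coveredBy_diag hR).abs_sum_sub_le hc (fun v => h.length_le_mul hku) (by positivity) i
          ((le_max_right _ _).trans hl)
    _ ≤ (1 / (k + 1) + 1 / (k + 1)) * l + 1 / (k + 1) * l := by
        gcongr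
        exact hl₀ l ((le_max_left _ _).trans hl)
    _ = 3 * (1 / (k + 1)) * l := by ring
    _ ≤ δ * l := by gcongr

lemma uniformRec_diag (h : IsRefinementChain ε Y 𝒢) : UniformRec fun i => Y i i := by
  intro m
  obtain ⟨R, hR⟩ := (h.refinement m).exists_length_le
  refine ⟨2 * R + 1, fun i => ?_⟩
  have hsubword : ∀ v ∈ 𝒢 (m + 1), word (fun i => Y i i) 0 m <:+: v := fun v hv => by
    rw [h.word_diag (k := m) (by omega)]
    exact (word_prefix_word (Y m) 0 (by nlinarith)).isInfix.trans
      ((h.refinement m).word_isInfix v hv)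
  simpa only [length_word] using (h.coveredBy_diag hR).exists_word_eq hsubword i

lemma sum_ind_ne_diag_le (h : IsRefinementChain ε Y 𝒢) (hε : 0 ≤ ε) (n : ℕ) :
    ∑ i ∈ range n, ind (Y 0 i ≠ Y i i) ≤ ε * n := by
  calc _ = ∑ i ∈ range n, ind (Y 0 i ≠ Y n i) :=
        Finset.sum_congr rfl fun i hi => by rw [h.diag_eq (Finset.mem_range.1 hi).le]
    _ ≤ ∑ k ∈ range n, ε * (1 / 2) ^ (k + 1) * n :=
        sum_ind_ne_le_sum (fun k => (h.refinement k).sum_ne_le n) n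
    _ = ε * (1 / 2) * n * ∑ k ∈ range n, (1 / 2 : ℝ) ^ k := by
        rw [Finset.mul_sum]
        exact Finset.sum_congr rfl fun k _ => by ring
    _ ≤ ε * (1 / 2) * n * 2 := by
        gcongr
        exact sum_geometric_two_le n
    _ = ε * n := by ring

end IsRefinementChain

theorem ErgSeq.exists_uniform [Finite A] {y : ℕ → A} (hy : ErgSeq y) {ε : ℝ} (hε : 0 < ε) :
    ∃ z, UniformFreq z ∧ UniformRec z ∧ ∀ n : ℕ, ∑ i ∈ range n, ind (y i ≠ z i) ≤ ε * n := by
  obtain ⟨Y, 𝒢, rfl, h⟩ := hy.exists_isRefinementChain hε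
  exact ⟨_, h.uniformFreq_diag, h.uniformRec_diag, h.sum_ind_ne_diag_le hε.le⟩

end Uniform

/-! ### Invariant measures -/

section Invariant

variable {X : Type*} [MeasurableSpace X] {T : X → X}

lemma exists_integral_eq_birkhoffAverage [MeasurableSingletonClass X] (T : X → X) (a : X) {n : ℕ}
    (hn : n ≠ 0) : ∃ P : ProbabilityMeasure X, ∀ f : X → ℂ,
      ∫ x, f x ∂(P : Measure X) = birkhoffAverage ℂ T f n a := by
  refine ⟨⟨(n : ENNReal)⁻¹ • ∑ i ∈ range n, Measure.dirac (T^[i] a), ⟨?_⟩⟩, fun f => ?_⟩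
  · simp only [Measure.smul_apply, Measure.finsetSum_apply, measure_univ, Finset.sum_const,
      Finset.card_range, nsmul_eq_mul, mul_one, smul_eq_mul]
    exact ENNReal.inv_mul_cancel (by exact_mod_cast hn) (ENNReal.natCast_ne_top n)
  · rw [ProbabilityMeasure.coe_mk, integral_smul_measure, integral_finsetSum_measure
      fun i _ => integrable_dirac (by simp)]
    simp [birkhoffAverage, birkhoffSum]

lemma ergodic_of_forall_eq {μ : Measure X} [IsProbabilityMeasure μ] (hμT : MeasurePreserving T μ μ)
    (hμ : ∀ ν : Measure X, IsProbabilityMeasure ν → MeasurePreserving T ν ν → ν = μ) :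
    Ergodic T μ := by
  refine .of_mem_extremePoints ⟨⟨hμT, inferInstance⟩, ?_⟩
  rintro ν ⟨hνT, hν⟩ - - -
  exact hμ ν hν hνT

variable [TopologicalSpace X]

lemma isGeneric_iff_birkhoffAverage {μ : Measure X} {a : X} :
    IsGeneric T μ a ↔ ∀ f : X → ℂ, Continuous f →
      Tendsto (birkhoffAverage ℂ T f · (T a)) atTop (𝓝 (∫ x, f x ∂μ)) := by
  simp only [IsGeneric, birkhoffAverage, birkhoffSum, Function.iterate_succ_apply, one_div,
    smul_eq_mul]

variable [CompactSpace X] [HasOuterApproxClosed X] [BorelSpace X]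

lemma measurePreserving_of_tendsto_birkhoffAverage (hT : Continuous T) (a : X) {l : Filter ℕ}
    [l.NeBot] (hl : l ≤ atTop) {μ : Measure X} [IsProbabilityMeasure μ]
    (h : ∀ f : X → ℂ, Continuous f →
      Tendsto (birkhoffAverage ℂ T f · a) l (𝓝 (∫ x, f x ∂μ))) :
    MeasurePreserving T μ μ := by
  refine ⟨hT.measurable, ?_⟩
  have : IsProbabilityMeasure (μ.map T) :=
    Measure.isProbabilityMeasure_map hT.measurable.aemeasurable
  refine ext_of_forall_integral_eq_of_IsFiniteMeasure fun f => ?_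
  rw [integral_map hT.measurable.aemeasurable f.continuous.aestronglyMeasurable,
    ← Complex.ofReal_inj, ← integral_complex_ofReal, ← integral_complex_ofReal]
  have hf : Continuous fun x => (f x : ℂ) := Complex.continuous_ofReal.comp f.continuous
  have hdiff : Tendsto (fun n => birkhoffAverage ℂ T (fun x => (f x : ℂ)) n (T a)
      - birkhoffAverage ℂ T (fun x => (f x : ℂ)) n a) l (𝓝 0) :=
    (tendsto_birkhoffAverage_apply_sub_birkhoffAverage' ℂ (isCompact_range hf).isBounded T
      a).mono_left hl
  refine tendsto_nhds_unique (h _ (hf.comp hT)) ?_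
  convert hdiff.add (h _ hf) using 2 with n
  · simp only [sub_add_cancel, birkhoffAverage, birkhoffSum, ← Function.iterate_succ_apply,
      Function.iterate_succ_apply']
  · rw [zero_add]

variable [T2Space X]

-- Krylov–Bogolyubov: a weak limit of empirical measures is invariant.
lemma exists_measurePreserving_of_ultrafilter (hT : Continuous T) (a : X) {𝒰 : Ultrafilter ℕ}
    (h𝒰 : (𝒰 : Filter ℕ) ≤ atTop) : ∃ μ : Measure X, IsProbabilityMeasure μ ∧
      MeasurePreserving T μ μ ∧ ∀ f : X → ℂ, Continuous f →
        Tendsto (birkhoffAverage ℂ T f · a) 𝒰 (𝓝 (∫ x, f x ∂μ)) := by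
  have : Nonempty (ProbabilityMeasure X) := ⟨Measure.dirac a, inferInstance⟩
  choose! P hP using fun n (hn : n ≠ 0) => exists_integral_eq_birkhoffAverage T a hn
  obtain ⟨μ, -, hμ⟩ := (isCompact_univ (X := ProbabilityMeasure X)).ultrafilter_le_nhds
    (𝒰.map P) (by simp)
  have hlim : ∀ f : X → ℂ, Continuous f →
      Tendsto (birkhoffAverage ℂ T f · a) 𝒰 (𝓝 (∫ x, f x ∂(μ : Measure X))) := fun f hf =>
    ((ProbabilityMeasure.tendsto_iff_forall_integral_rclike_tendsto ℂ).1 hμ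
      (.mkOfCompact ⟨f, hf⟩)).congr' <|
        ((eventually_ne_atTop 0).filter_mono h𝒰).mono fun n hn => hP n hn f
  exact ⟨μ, inferInstance, measurePreserving_of_tendsto_birkhoffAverage hT a h𝒰 hlim, hlim⟩

lemma exists_measurePreserving [Nonempty X] (hT : Continuous T) :
    ∃ μ : Measure X, IsProbabilityMeasure μ ∧ MeasurePreserving T μ μ := by
  obtain ⟨μ, hμ, hμT, -⟩ := exists_measurePreserving_of_ultrafilter hT (Classical.arbitrary X)
    (𝒰 := hyperfilter ℕ) Nat.hyperfilter_le_atTop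
  exact ⟨μ, hμ, hμT⟩

lemma isGeneric_of_forall_eq (hT : Continuous T) {μ : Measure X}
    (hμ : ∀ ν : Measure X, IsProbabilityMeasure ν → MeasurePreserving T ν ν → ν = μ) (a : X) :
    IsGeneric T μ a := by
  refine isGeneric_iff_birkhoffAverage.2 fun f hf => (tendsto_iff_ultrafilter _ _ _).2
    fun 𝒰 h𝒰 => ?_
  obtain ⟨ν, hν, hνT, hlim⟩ := exists_measurePreserving_of_ultrafilter hT (T a) h𝒰
  exact hμ ν hν hνT ▸ hlim f hf

end Invariant

lemma shift_iterate_apply (y : ℕ → A) (i n : ℕ) : shift^[i] y n = y (i + n) := by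
  induction i generalizing y with
  | zero => rw [zero_add, Function.iterate_zero_apply]
  | succ i ih => rw [Function.iterate_succ_apply, ih, shift, add_right_comm]

lemma word_shift_iterate (y : ℕ → A) (i p m : ℕ) : word (shift^[i] y) p m = word y (i + p) m :=
  word_eq_word_iff.2 fun _ _ => by rw [shift_iterate_apply, add_assoc]

lemma mem_cylinder_iff_word_eq {ξ η : ℕ → A} {m : ℕ} :
    η ∈ PiNat.cylinder ξ m ↔ word η 0 m = word ξ 0 m := by
  simp only [PiNat.mem_cylinder_iff, word_eq_word_iff, zero_add]

lemma isPiSystem_cylinder :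
    IsPiSystem {s : Set (ℕ → A) | ∃ (ξ : ℕ → A) (m : ℕ), s = PiNat.cylinder ξ m} := by
  rintro _ ⟨ξ, m, rfl⟩ _ ⟨ζ, n, rfl⟩ ⟨η, hηξ, hηζ⟩
  rw [← PiNat.mem_cylinder_iff_eq.1 hηξ, ← PiNat.mem_cylinder_iff_eq.1 hηζ]
  rcases le_total m n with h | h
  · exact ⟨η, n, Set.inter_eq_right.2 (PiNat.cylinder_anti η h)⟩
  · exact ⟨η, m, Set.inter_eq_left.2 (PiNat.cylinder_anti η h)⟩

lemma IsMinimal.surjective {X : Type*} [TopologicalSpace X] [CompactSpace X] [T2Space X]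
    {T : X → X} (hmin : IsMinimal T) (hT : Continuous T) : Function.Surjective T := fun x => by
  have horbit : Set.range (fun n => T^[n] (T x)) ⊆ Set.range T := by
    rintro _ ⟨n, rfl⟩
    exact ⟨T^[n] x, by rw [← Function.iterate_succ_apply' T, Function.iterate_succ_apply]⟩
  exact (isCompact_range hT).isClosed.closure_subset_iff.2 horbit (hmin (T x) x)

section OrbitClosure

variable [TopologicalSpace A]

lemma continuous_shift : Continuous (shift : (ℕ → A) → ℕ → A) :=
  continuous_pi fun n => continuous_apply (n + 1)

/-- The closure of the forward orbit of `z` under the shift. -/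
def orbitClosure (z : ℕ → A) : Set (ℕ → A) := closure (Set.range fun p => shift^[p] z)

lemma mapsTo_shift_orbitClosure (z : ℕ → A) :
    Set.MapsTo shift (orbitClosure z) (orbitClosure z) := by
  refine Set.MapsTo.closure ?_ continuous_shift
  rintro _ ⟨p, rfl⟩
  exact ⟨p + 1, Function.iterate_succ_apply' shift p z⟩

/-- The shift as a self-map of the orbit closure of `z`. -/
def orbitShift (z : ℕ → A) : orbitClosure z → orbitClosure z :=
  (mapsTo_shift_orbitClosure z).restrict

lemma continuous_orbitShift (z : ℕ → A) : Continuous (orbitShift z) :=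
  continuous_shift.restrict _

lemma coe_orbitShift_iterate {z : ℕ → A} (ξ : orbitClosure z) (i : ℕ) :
    ((orbitShift z)^[i] ξ : ℕ → A) = shift^[i] ξ := by
  rw [orbitShift, Set.MapsTo.iterate_restrict, Set.MapsTo.val_restrict_apply]

variable [DiscreteTopology A]

lemma mem_orbitClosure_iff {z ξ : ℕ → A} :
    ξ ∈ orbitClosure z ↔ ∀ m, ∃ p, word ξ 0 m = word z p m := by
  rw [orbitClosure, (PiNat.isTopologicalBasis_cylinders fun _ => A).mem_closure_iff]
  constructor
  · intro h m
    obtain ⟨_, hp, p, rfl⟩ := h _ ⟨ξ, m, rfl⟩ (PiNat.self_mem_cylinder ξ m)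
    refine ⟨p, ?_⟩
    rw [← mem_cylinder_iff_word_eq.1 hp, word_shift_iterate, add_zero]
  · rintro h _ ⟨x, m, rfl⟩ hξ
    obtain ⟨p, hp⟩ := h m
    refine ⟨shift^[p] z, mem_cylinder_iff_word_eq.2 ?_, p, rfl⟩
    rw [word_shift_iterate, add_zero, ← hp, mem_cylinder_iff_word_eq.1 hξ]

lemma isTopologicalBasis_orbitClosure (z : ℕ → A) :
    TopologicalSpace.IsTopologicalBasis (Set.preimage ((↑) : orbitClosure z → ℕ → A) ''
      {s | ∃ (ξ : ℕ → A) (m : ℕ), s = PiNat.cylinder ξ m}) :=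
  (PiNat.isTopologicalBasis_cylinders fun _ => A).isInducing .subtypeVal

lemma isLocallyConstant_word (m : ℕ) : IsLocallyConstant fun ξ : ℕ → A => word ξ 0 m :=
  (IsLocallyConstant.iff_eventually_eq _).2 fun ξ => mem_of_superset
    ((PiNat.isOpen_cylinder _ ξ m).mem_nhds (PiNat.self_mem_cylinder ξ m))
    fun _ hη => mem_cylinder_iff_word_eq.1 hη

lemma UniformRec.isMinimal {z : ℕ → A} (hz : UniformRec z) : IsMinimal (orbitShift z) := by
  intro ξ ζ
  refine (isTopologicalBasis_orbitClosure z).mem_closure_iff.2 ?_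
  rintro _ ⟨_, ⟨x, m, rfl⟩, rfl⟩ hζ
  obtain ⟨p, hp⟩ := mem_orbitClosure_iff.1 ζ.2 m
  obtain ⟨R, hR⟩ := hz (p + m)
  obtain ⟨q, hq⟩ := mem_orbitClosure_iff.1 ξ.2 (R + (p + m))
  obtain ⟨j, hj, hjm⟩ := hR q
  refine ⟨(orbitShift z)^[j + p] ξ, mem_cylinder_iff_word_eq.2 ?_, j + p, rfl⟩
  rw [coe_orbitShift_iterate, word_shift_iterate, ← mem_cylinder_iff_word_eq.1 hζ, hp, add_zero]
  refine word_eq_word_iff.2 fun t ht => ?_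
  calc ξ.1 (j + p + t) = z (q + (j + p + t)) := by
        simpa using word_eq_word_iff.1 hq (j + p + t) (by omega)
    _ = z (p + t) := by
        simpa [add_assoc] using word_eq_word_iff.1 hjm (p + t) (by omega)

end OrbitClosure

section UniqueErgodicity

variable {X : Type*} [MeasurableSpace X] {T : X → X} {μ : Measure X} {f : X → ℝ}

lemma integral_birkhoffAverage (hT : MeasurePreserving T μ μ) (hf : Integrable f μ) {l : ℕ}
    (hl : l ≠ 0) : ∫ x, birkhoffAverage ℝ T f l x ∂μ = ∫ x, f x ∂μ := by
  have hfj : ∀ j, ∫ x, f (T^[j] x) ∂μ = ∫ x, f x ∂μ := fun j => by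
    have hTj := hT.iterate j
    rw [← integral_map hTj.aemeasurable (hTj.map_eq.symm ▸ hf.aestronglyMeasurable), hTj.map_eq]
  have hint : ∀ j ∈ range l, Integrable (fun x => f (T^[j] x)) μ := fun j _ =>
    (hT.iterate j).integrable_comp_of_integrable hf
  simp only [birkhoffAverage, birkhoffSum, integral_smul]
  rw [integral_finsetSum _ hint]
  simp [hfj, hl]

lemma abs_integral_sub_le_of_birkhoffAverage [IsProbabilityMeasure μ] (hT : MeasurePreserving T μ μ)
    (hf : Integrable f μ) {l : ℕ} (hl : l ≠ 0) {c δ : ℝ}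
    (h : ∀ x, |birkhoffAverage ℝ T f l x - c| ≤ δ) : |∫ x, f x ∂μ - c| ≤ δ := by
  have hint : Integrable (birkhoffAverage ℝ T f l) μ := by
    refine (integrable_finsetSum (range l) (f := fun j x => f (T^[j] x)) fun j _ => ?_).smul
      (l : ℝ)⁻¹
    exact (hT.iterate j).integrable_comp_of_integrable hf
  calc |∫ x, f x ∂μ - c| = ‖∫ x, (birkhoffAverage ℝ T f l x - c) ∂μ‖ := by
        rw [integral_sub hint (integrable_const c), integral_birkhoffAverage hT hf hl]
        simp
    _ ≤ δ * μ.real Set.univ := norm_integral_le_of_norm_le_const (.of_forall h)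
    _ = δ := by simp

variable [TopologicalSpace A] {z : ℕ → A}

lemma UniformFreq.exists_birkhoffAverage [DiscreteTopology A] (hz : UniformFreq z) (u : List A)
    {δ : ℝ} (hδ : 0 < δ) : ∃ c : ℝ, ∃ l ≠ 0, ∀ ξ, |birkhoffAverage ℝ (orbitShift z)
      (fun ξ => ind (word ξ.1 0 u.length = u)) l ξ - c| ≤ δ := by
  obtain ⟨c, l₀, hl₀⟩ := hz u δ hδ
  refine ⟨c, l₀ + 1, l₀.succ_ne_zero, fun ξ => ?_⟩
  obtain ⟨p, hp⟩ := mem_orbitClosure_iff.1 ξ.2 (l₀ + 1 + u.length)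
  have hsum : birkhoffSum (orbitShift z) (fun ξ => ind (word ξ.1 0 u.length = u)) (l₀ + 1) ξ
      = ∑ j ∈ range (l₀ + 1), ind (word z (p + j) u.length = u) := by
    refine Finset.sum_congr rfl fun j hj => ?_
    have hword : word ξ.1 j u.length = word z (p + j) u.length := word_eq_word_iff.2 fun t ht => by
      have hj := Finset.mem_range.1 hj
      simpa [add_assoc] using word_eq_word_iff.1 hp (j + t) (by omega)
    simp only [coe_orbitShift_iterate, word_shift_iterate, add_zero, hword]
  have hl : (0 : ℝ) < (l₀ + 1 : ℕ) := by positivity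
  refine le_of_mul_le_mul_right (le_of_eq_of_le ?_ (hl₀ (l₀ + 1) l₀.le_succ p)) hl
  rw [← abs_of_pos hl, ← abs_mul, abs_of_pos hl, birkhoffAverage, hsum, smul_eq_mul, sub_mul,
    mul_right_comm, inv_mul_cancel₀ hl.ne', one_mul]

variable [DiscreteTopology A] [MeasurableSpace (orbitClosure z)] [BorelSpace (orbitClosure z)]
  {μ ν : Measure (orbitClosure z)} [IsProbabilityMeasure μ] [IsProbabilityMeasure ν]

lemma UniformFreq.measure_word_eq (hz : UniformFreq z)
    (hμ : MeasurePreserving (orbitShift z) μ μ) (hν : MeasurePreserving (orbitShift z) ν ν)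
    (u : List A) : μ {ξ | word ξ.1 0 u.length = u} = ν {ξ | word ξ.1 0 u.length = u} := by
  have hS : MeasurableSet {ξ : orbitClosure z | word ξ.1 0 u.length = u} :=
    (((isLocallyConstant_word u.length).comp_continuous
      continuous_subtype_val).isOpen_fiber u).measurableSet
  have hind : (fun ξ : orbitClosure z => ind (word ξ.1 0 u.length = u))
      = {ξ : orbitClosure z | word ξ.1 0 u.length = u}.indicator 1 := by
    ext ξ
    by_cases hξ : word ξ.1 0 u.length = u <;> simp [ind, hξ]
  rw [← measureReal_eq_measureReal_iff]
  refine eq_of_forall_dist_le fun ε hε => ?_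
  obtain ⟨c, l, hl, h⟩ := hz.exists_birkhoffAverage u (half_pos hε)
  have hclose : ∀ ρ : Measure (orbitClosure z), IsProbabilityMeasure ρ →
      MeasurePreserving (orbitShift z) ρ ρ →
      dist (ρ.real {ξ | word ξ.1 0 u.length = u}) c ≤ ε / 2 := fun ρ _ hρ => by
    rw [← integral_indicator_one hS, ← hind, Real.dist_eq]
    refine abs_integral_sub_le_of_birkhoffAverage hρ ?_ hl h
    rw [hind]
    exact (integrable_const 1).indicator hS
  calc _ ≤ _ := dist_triangle_right _ _ c
    _ ≤ ε / 2 + ε / 2 := add_le_add (hclose μ inferInstance hμ) (hclose ν inferInstance hν)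
    _ = ε := add_halves ε

lemma UniformFreq.eq_of_measurePreserving [Finite A] (hz : UniformFreq z)
    (hμ : MeasurePreserving (orbitShift z) μ μ) (hν : MeasurePreserving (orbitShift z) ν ν) :
    μ = ν := by
  refine ext_of_generate_finite _ ?_ (isPiSystem_cylinder.comap Subtype.val) ?_ (by simp)
  · rw [BorelSpace.measurable_eq (α := orbitClosure z)]
    exact (isTopologicalBasis_orbitClosure z).borel_eq_generateFrom
  · rintro _ ⟨_, ⟨x, m, rfl⟩, rfl⟩
    have hcyl : ((↑) : orbitClosure z → ℕ → A) ⁻¹' PiNat.cylinder x m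
        = {ξ | word ξ.1 0 (word x 0 m).length = word x 0 m} := by
      ext ξ
      simp [-PiNat.mem_cylinder_iff, mem_cylinder_iff_word_eq]
    rw [hcyl, hz.measure_word_eq hμ hν]

end UniqueErgodicity

theorem UniformFreq.isStrictlyErgodicSeq {A : Type} [Finite A] {z : ℕ → A} (hf : UniformFreq z)
    (hr : UniformRec z) (g : A → ℂ) : IsStrictlyErgodicSeq fun n => g (z n) := by
  let : TopologicalSpace A := ⊥
  have : DiscreteTopology A := ⟨rfl⟩
  let : MetricSpace (orbitClosure z) := TopologicalSpace.metrizableSpaceMetric _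
  have : CompactSpace (orbitClosure z) := isCompact_iff_compactSpace.1 isClosed_closure.isCompact
  let : MeasurableSpace (orbitClosure z) := borel _
  have : BorelSpace (orbitClosure z) := ⟨rfl⟩
  let z' : orbitClosure z := ⟨z, subset_closure ⟨0, rfl⟩⟩
  have : Nonempty (orbitClosure z) := ⟨z'⟩
  have hT := continuous_orbitShift z
  obtain ⟨a, ha⟩ := hr.isMinimal.surjective hT z'
  obtain ⟨μ, hμ, hμT⟩ := exists_measurePreserving hT
  refine ⟨orbitClosure z, inferInstance, inferInstance, inferInstance, inferInstance, orbitShift z,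
    fun ξ => g (ξ.1 0), a, hT, ⟨hr.isMinimal, μ, ⟨hμ, hμT⟩, ?_⟩, ?_, fun n => ?_⟩
  · rintro ν ⟨_, hνT⟩
    exact hf.eq_of_measurePreserving hνT hμT
  · exact continuous_of_discreteTopology.comp ((continuous_apply 0).comp continuous_subtype_val)
  · simp only [Function.iterate_succ_apply, ha, coe_orbitShift_iterate, shift_iterate_apply,
      add_zero, z']

/-! ### Generic points -/

section MeanErgodic

variable {X E : Type*} [MeasurableSpace X] [NormedAddCommGroup E] {T : X → X}
  {μ : Measure X} {p : ENNReal}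

lemma integral_norm_le_norm [IsProbabilityMeasure μ] [Fact (1 ≤ p)] (F : Lp E p μ) :
    ∫ x, ‖F x‖ ∂μ ≤ ‖F‖ := by
  rw [integral_norm_eq_lintegral_enorm (Lp.aestronglyMeasurable F), Lp.norm_def,
    ← eLpNorm_one_eq_lintegral_enorm]
  exact ENNReal.toReal_mono (Lp.eLpNorm_ne_top F)
    (eLpNorm_le_eLpNorm_of_exponent_le Fact.out (Lp.aestronglyMeasurable F))

lemma coeFn_birkhoffAverage_compMeasurePreserving [NormedSpace ℝ E]
    (hT : MeasurePreserving T μ μ) (F : Lp E p μ) (n : ℕ) :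
    (birkhoffAverage ℝ (Lp.compMeasurePreserving T hT) _root_.id n F : Lp E p μ) =ᵐ[μ]
      birkhoffAverage ℝ T F n := by
  have hiter : ∀ j ∈ range n, (Lp.compMeasurePreserving T hT)^[j] F =ᵐ[μ] fun x => F (T^[j] x) :=
    fun j _ => by
      rw [Lp.compMeasurePreserving_iterate]
      exact Lp.coeFn_compMeasurePreserving F (hT.iterate j)
  filter_upwards [Lp.coeFn_smul (n : ℝ)⁻¹ (∑ j ∈ range n, (Lp.compMeasurePreserving T hT)^[j] F),
    Lp.coeFn_finsetSum (range n) fun j => (Lp.compMeasurePreserving T hT)^[j] F,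
    (eventually_all_finset _).2 hiter] with x hsmul hsum hx
  simp only [birkhoffAverage, birkhoffSum, id]
  rw [hsmul, Pi.smul_apply, hsum, Finset.sum_apply, Finset.sum_congr rfl hx]

lemma exists_tendsto_birkhoffAverage_const [IsProbabilityMeasure μ] (hT : Ergodic T μ)
    (F : Lp ℝ 2 μ) : ∃ c : ℝ, Tendsto
      (birkhoffAverage ℝ (Lp.compMeasurePreserving T hT.toMeasurePreserving) _root_.id · F) atTop
      (𝓝 (Lp.const 2 μ c)) := by
  let V := (Lp.compMeasurePreservingₗᵢ (E := ℝ) (p := 2) ℝ T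
    hT.toMeasurePreserving).toContinuousLinearMap
  have hlim := V.tendsto_birkhoffAverage_orthogonalProjection
    (LinearIsometry.norm_toContinuousLinearMap_le _) F
  set G := (V.eqLocus (1 : Lp ℝ 2 μ →L[ℝ] Lp ℝ 2 μ)).orthogonalProjectionOnto F
  have hG : Lp.compMeasurePreserving T hT.toMeasurePreserving (G : Lp ℝ 2 μ) = G := G.2
  obtain ⟨c, hc⟩ : ∃ c : ℝ, (G : Lp ℝ 2 μ) =ᵐ[μ] fun _ => c :=
    hT.ae_eq_const_of_ae_eq_comp_ae (Lp.aestronglyMeasurable _) <| by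
      simpa only [hG] using (Lp.coeFn_compMeasurePreserving (G : Lp ℝ 2 μ)
        hT.toMeasurePreserving).symm
  refine ⟨c, ?_⟩
  rwa [← Lp.ext (hc.trans (Lp.coeFn_const (p := 2) (μ := μ) c).symm)]

lemma exists_tendsto_integral_abs_birkhoffAverage_sub [IsProbabilityMeasure μ] (hT : Ergodic T μ)
    {f : X → ℝ} (hf : MemLp f 2 μ) :
    ∃ c : ℝ, Tendsto (fun n => ∫ x, |birkhoffAverage ℝ T f n x - c| ∂μ) atTop (𝓝 0) := by
  obtain ⟨c, hc⟩ := exists_tendsto_birkhoffAverage_const hT (hf.toLp f)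
  refine ⟨c, squeeze_zero (fun _ => integral_nonneg fun _ => abs_nonneg _) (fun n => ?_)
    (tendsto_iff_norm_sub_tendsto_zero.1 hc)⟩
  refine (integral_congr_ae ?_).trans_le (integral_norm_le_norm _)
  have hmp := hT.toMeasurePreserving
  filter_upwards [Lp.coeFn_sub (birkhoffAverage ℝ (Lp.compMeasurePreserving T hmp) _root_.id n
      (hf.toLp f)) (Lp.const 2 μ c), Lp.coeFn_const (p := 2) (μ := μ) c,
    coeFn_birkhoffAverage_compMeasurePreserving hmp (hf.toLp f) n,
    hmp.quasiMeasurePreserving.birkhoffAverage_ae_eq_of_ae_eq ℝ hf.coeFn_toLp n]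
    with x hsub hconst havg hf
  rw [hsub, Pi.sub_apply, hconst, havg, hf, Real.norm_eq_abs, Function.const_apply]

end MeanErgodic

section Generic

variable {X : Type*} [TopologicalSpace X] [MeasurableSpace X] {T : X → X} {μ : Measure X} {a : X}

lemma IsGeneric.tendsto_birkhoffAverage (ha : IsGeneric T μ a) {f : X → ℝ} (hf : Continuous f) :
    Tendsto (birkhoffAverage ℝ T f · (T a)) atTop (𝓝 (∫ x, f x ∂μ)) := by
  have hlim := isGeneric_iff_birkhoffAverage.1 ha _ (Complex.continuous_ofReal.comp hf)
  simp only [Function.comp_def, integral_complex_ofReal] at hlim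
  refine ((Complex.continuous_re.tendsto _).comp hlim).congr fun n => ?_
  simp only [Function.comp_apply, birkhoffAverage, birkhoffSum, smul_eq_mul,
    ← Complex.ofReal_sum, ← Complex.ofReal_natCast, ← Complex.ofReal_inv, ← Complex.ofReal_mul,
    Complex.ofReal_re]

lemma IsGeneric.exists_hasMean [CompactSpace X] [OpensMeasurableSpace X] [IsProbabilityMeasure μ]
    (hμ : Ergodic T μ) (hT : Continuous T) (ha : IsGeneric T μ a) {f : X → ℝ}
    (hf : Continuous f) : ∃ c, HasMean (fun i => f (T^[i] (T a))) c := by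
  have hLp : MemLp f 2 μ := by
    obtain ⟨M, hM⟩ := (isCompact_range hf).isBounded.exists_norm_le
    exact .of_bound hf.aestronglyMeasurable M (.of_forall fun x => hM _ ⟨x, rfl⟩)
  obtain ⟨c, hc⟩ := exists_tendsto_integral_abs_birkhoffAverage_sub hμ hLp
  refine ⟨c, fun ε hε => ?_⟩
  filter_upwards [hc.eventually_lt_const hε] with N hN
  have hcont : Continuous fun x => |birkhoffAverage ℝ T f N x - c| := by
    simp only [birkhoffAverage, birkhoffSum]
    fun_prop
  filter_upwards [(ha.tendsto_birkhoffAverage hcont).eventually_lt_const hN,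
    eventually_gt_atTop 0] with n hn hn0
  have hn0' : (0 : ℝ) < n := by exact_mod_cast hn0
  rw [birkhoffAverage, smul_eq_mul, inv_mul_lt_iff₀ hn0', mul_comm] at hn
  refine (Finset.sum_congr rfl fun i _ => ?_).trans_le hn.le
  simp only [windowMean, birkhoffAverage, birkhoffSum, ← Function.iterate_add_apply, add_comm i,
    smul_eq_mul, inv_mul_eq_div]

lemma IsGeneric.ergSeq [TopologicalSpace A] [DiscreteTopology A] [Finite A] [MeasurableSpace A]
    [BorelSpace A] {y : ℕ → A} {ν : Measure (ℕ → A)} [IsProbabilityMeasure ν]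
    (hν : Ergodic shift ν) (hy : IsGeneric shift ν y) : ErgSeq y := by
  rintro v ⟨D, hD⟩
  let f : (ℕ → A) → ℝ := fun ξ =>
    ind (∃ i, word y i (2 * D + 1) = word ξ 0 (2 * D + 1) ∧ v (D + i))
  have hf : Continuous f := ((isLocallyConstant_word (2 * D + 1)).comp fun u =>
    ind (∃ i, word y i (2 * D + 1) = u ∧ v (D + i))).continuous
  have hfv : ∀ i, f (shift^[i] (shift y)) = ind (v (D + 1 + i)) := fun i => by
    simp only [f, ← Function.iterate_succ_apply, word_shift_iterate, add_zero]
    congr 1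
    refine propext ⟨?_, fun hv => ⟨i + 1, rfl, by rwa [add_assoc, add_comm 1] at hv⟩⟩
    rintro ⟨j, hj, hvj⟩
    rwa [hD j (i + 1) fun t ht => word_eq_word_iff.1 hj t (by omega), ← add_assoc,
      add_right_comm] at hvj
  obtain ⟨c, hc⟩ := hy.exists_hasMean hν continuous_shift hf
  exact ⟨c, HasMean.of_shift (by simpa only [hfv] using hc)⟩

end Generic

lemma IsStrictlyErgodicSeq.isGenericForErgodic {K : Finset ℂ} {y : ℕ → K}
    (hy : IsStrictlyErgodicSeq fun n => (y n : ℂ)) : IsGenericForErgodic y := by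
  obtain ⟨X, _, _, _, _, T, f, a, hT, ⟨hmin, μ, ⟨hμ, hμT⟩, huniq⟩, hf, hfy⟩ := hy
  replace hfy : ∀ n, (y n : ℂ) = f (T^[n] (T a)) := hfy
  replace huniq : ∀ ν, IsProbabilityMeasure ν → MeasurePreserving T ν ν → ν = μ :=
    fun ν hν hνT => huniq ν ⟨hν, hνT⟩
  have hfK : ∀ x, f x ∈ K := fun x => by
    have horbit : Set.range (fun n => T^[n] (T a)) ⊆ f ⁻¹' K := by
      rintro _ ⟨n, rfl⟩
      exact Set.mem_preimage.2 (hfy n ▸ (y n).2)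
    exact closure_minimal horbit (K.finite_toSet.isClosed.preimage hf) (hmin (T a) x)
  let π : X → ℕ → K := fun x n => ⟨f (T^[n] x), hfK _⟩
  have hπ : Continuous π := continuous_pi fun n => (hf.comp (hT.iterate n)).subtype_mk _
  have hsemi : Function.Semiconj π T shift := fun _ => rfl
  have hyπ : y = π (T a) := funext fun n => Subtype.ext (hfy n)
  refine ⟨μ.map π, Measure.isProbabilityMeasure_map hπ.aemeasurable,
    (hπ.measurable.measurePreserving μ).ergodic_of_ergodic_semiconj
      (ergodic_of_forall_eq hμT huniq) continuous_shift.measurable hsemi, fun F hF => ?_⟩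
  rw [integral_map hπ.aemeasurable hF.aestronglyMeasurable, hyπ]
  refine (isGeneric_of_forall_eq hT huniq (T a) _ (hF.comp hπ)).congr fun n => ?_
  simp only [Function.comp_apply, (hsemi.iterate_right _).eq]

/-! ### Correlations -/

section Correlation

variable {x : ℕ → ℂ} {M : ℝ}

lemma norm_average_le {u : ℕ → ℂ} {δ : ℝ} {n : ℕ} (hδ : 0 ≤ δ)
    (hu : ∑ i ∈ range n, ‖u i‖ ≤ δ * n) : ‖(1 / (n : ℂ)) * ∑ i ∈ range n, u i‖ ≤ δ := by
  rw [one_div, norm_mul, norm_inv, Complex.norm_natCast, ← div_eq_inv_mul]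
  exact div_le_of_le_mul₀ n.cast_nonneg hδ ((norm_sum_le _ _).trans hu)

lemma sum_norm_le {u : ℕ → ℂ} (hu : ∀ i, ‖u i‖ ≤ M) (n : ℕ) :
    ∑ i ∈ range n, ‖u i‖ ≤ M * n := by
  simpa [mul_comm] using Finset.sum_le_card_nsmul (range n) _ M fun i _ => hu i

lemma norm_corr_le (hx : ∀ i, ‖x i‖ ≤ M) {u : ℕ → ℂ} {δ : ℝ} {n : ℕ} (hδ : 0 ≤ δ)
    (hu : ∑ i ∈ range n, ‖u i‖ ≤ δ * n) : ‖corr x u n‖ ≤ 2 * (M * δ) := by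
  have hM : 0 ≤ M := (norm_nonneg _).trans (hx 0)
  have hxu : ‖(1 / (n : ℂ)) * ∑ i ∈ range n, x i * (starRingEnd ℂ) (u i)‖ ≤ M * δ := by
    refine norm_average_le (mul_nonneg hM hδ) ?_
    calc ∑ i ∈ range n, ‖x i * (starRingEnd ℂ) (u i)‖
        ≤ ∑ i ∈ range n, M * ‖u i‖ := Finset.sum_le_sum fun i _ => by
          rw [norm_mul, RCLike.norm_conj]
          exact mul_le_mul_of_nonneg_right (hx i) (norm_nonneg _)
      _ ≤ M * δ * n := by
          rw [← Finset.mul_sum, mul_assoc]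
          exact mul_le_mul_of_nonneg_left hu hM
  have hx' := norm_average_le hM (sum_norm_le hx n)
  have hu' : ‖(1 / (n : ℂ)) * ∑ i ∈ range n, (starRingEnd ℂ) (u i)‖ ≤ δ :=
    norm_average_le hδ (by simpa only [RCLike.norm_conj] using hu)
  rw [two_mul]
  refine (norm_sub_le _ _).trans (add_le_add hxu ?_)
  rw [norm_mul]
  exact mul_le_mul hx' hu' (norm_nonneg _) hM

lemma corr_sub_right (x y z : ℕ → ℂ) (n : ℕ) :
    corr x (fun i => y i - z i) n = corr x y n - corr x z n := by
  simp only [corr, map_sub, mul_sub, Finset.sum_sub_distrib]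
  ring

lemma norm_corr_le_add (hx : ∀ i, ‖x i‖ ≤ M) {y z : ℕ → ℂ} {R ε : ℝ} (hy : ∀ i, ‖y i‖ ≤ R)
    (hz : ∀ i, ‖z i‖ ≤ R) (hε : 0 ≤ ε) {n : ℕ} (h : ∑ i ∈ range n, ind (y i ≠ z i) ≤ ε * n) :
    ‖corr x y n‖ ≤ ‖corr x z n‖ + 4 * (M * R * ε) := by
  have hR : 0 ≤ R := (norm_nonneg _).trans (hy 0)
  have hyz : ∀ i, ‖y i - z i‖ ≤ 2 * R * ind (y i ≠ z i) := fun i => by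
    by_cases hi : y i = z i
    · rw [hi, sub_self, norm_zero]
      exact mul_nonneg (mul_nonneg zero_le_two hR) (ind_nonneg _)
    · rw [ind_of hi, mul_one, two_mul]
      exact norm_sub_le_of_le (hy i) (hz i)
  have hsum : ∑ i ∈ range n, ‖y i - z i‖ ≤ 2 * R * ε * n := by
    refine (Finset.sum_le_sum fun i _ => hyz i).trans ?_
    rw [← Finset.mul_sum, mul_assoc _ ε]
    exact mul_le_mul_of_nonneg_left h (mul_nonneg zero_le_two hR)
  have hcorr := norm_corr_le hx (mul_nonneg (mul_nonneg zero_le_two hR) hε) hsum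
  rw [corr_sub_right] at hcorr
  linarith [norm_sub_norm_le (corr x y n) (corr x z n)]

end Correlation

lemma exists_frequently_of_pos_limsup {u : ℕ → ℝ} (hu : ∀ n, 0 ≤ u n) (h : 0 < limsup u atTop) :
    ∃ c > 0, ∃ᶠ n in atTop, c ≤ u n :=
  ⟨_, half_pos h, (frequently_lt_of_lt_limsup
    (isBoundedUnder_of ⟨0, hu⟩ : IsBoundedUnder (· ≥ ·) atTop u).isCoboundedUnder_le
    (half_lt_self h)).mono fun _ hn => hn.le⟩

lemma exists_eventually_of_pos_liminf {u : ℕ → ℝ} (hu : ∀ n, 0 ≤ u n) (h : 0 < liminf u atTop) :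
    ∃ c > 0, ∀ᶠ n in atTop, c ≤ u n :=
  ⟨_, half_pos h, (eventually_lt_of_lt_liminf (half_lt_self h)
    (isBoundedUnder_of ⟨0, hu⟩)).mono fun _ hn => hn.le⟩

section Genericity

variable {K : Finset ℂ} {x : ℕ → ℂ} {y : ℕ → K} {M : ℝ}

theorem IsGenericForErgodic.exists_isStrictlyErgodicSeq (hy : IsGenericForErgodic y) {ε : ℝ}
    (hε : 0 < ε) : ∃ z : ℕ → K, IsStrictlyErgodicSeq (fun n => (z n : ℂ)) ∧
      ∀ n : ℕ, ∑ i ∈ range n, ind (y i ≠ z i) ≤ ε * n := by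
  obtain ⟨ν, _, hν, hyν⟩ := hy
  obtain ⟨z, hf, hr, hz⟩ := (hyν.ergSeq hν).exists_uniform hε
  exact ⟨z, hf.isStrictlyErgodicSeq hr fun k => (k : ℂ), hz⟩

lemma exists_forall_norm_le (K : Finset ℂ) : ∃ R, ∀ k : K, ‖(k : ℂ)‖ ≤ R :=
  let ⟨R, hR⟩ := K.finite_toSet.isBounded.exists_norm_le
  ⟨R, fun k => hR _ k.2⟩

lemma isBoundedUnder_norm_corr (hx : ∀ i, ‖x i‖ ≤ M) (z : ℕ → K) :
    IsBoundedUnder (· ≤ ·) atTop fun n => ‖corr x (fun i => (z i : ℂ)) n‖ := by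
  obtain ⟨R, hR⟩ := exists_forall_norm_le K
  exact isBoundedUnder_of ⟨_, fun n =>
    norm_corr_le hx ((norm_nonneg _).trans (hR (z 0))) (sum_norm_le (fun i => hR (z i)) n)⟩

lemma IsGenericForErgodic.exists_norm_corr_le (hx : ∀ i, ‖x i‖ ≤ M)
    (hy : IsGenericForErgodic y) {δ : ℝ} (hδ : 0 < δ) :
    ∃ z : ℕ → K, IsStrictlyErgodicSeq (fun n => (z n : ℂ)) ∧
      ∀ n, ‖corr x (fun i => (y i : ℂ)) n‖ ≤ ‖corr x (fun i => (z i : ℂ)) n‖ + δ := by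
  obtain ⟨R, hR⟩ := exists_forall_norm_le K
  obtain ⟨ε, hε, hεδ⟩ : ∃ ε > 0, 4 * (M * R) * ε < δ := exists_pos_mul_lt hδ _
  obtain ⟨z, hz, hyz⟩ := hy.exists_isStrictlyErgodicSeq hε
  refine ⟨z, hz, fun n => ?_⟩
  have hcorr := norm_corr_le_add hx (fun i => hR (y i)) (fun i => hR (z i)) hε.le
    (by simpa only [ne_eq, SetLike.coe_eq_coe] using hyz n)
  linarith

theorem IsGenericForErgodic.exists_weaklyCorrelated (hx : ∀ i, ‖x i‖ ≤ M)
    (hy : IsGenericForErgodic y) (h : WeaklyCorrelated x fun n => (y n : ℂ)) :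
    ∃ z : ℕ → K, IsStrictlyErgodicSeq (fun n => (z n : ℂ)) ∧
      WeaklyCorrelated x fun n => (z n : ℂ) := by
  obtain ⟨c, hc, hfreq⟩ := exists_frequently_of_pos_limsup (fun n => norm_nonneg _) h
  obtain ⟨z, hz, hyz⟩ := hy.exists_norm_corr_le hx (half_pos hc)
  exact ⟨z, hz, (half_pos hc).trans_le (le_limsup_of_frequently_le
    (hfreq.mono fun n hn => by linarith [hyz n]) (isBoundedUnder_norm_corr hx z))⟩

theorem IsGenericForErgodic.exists_stronglyCorrelated (hx : ∀ i, ‖x i‖ ≤ M)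
    (hy : IsGenericForErgodic y) (h : StronglyCorrelated x fun n => (y n : ℂ)) :
    ∃ z : ℕ → K, IsStrictlyErgodicSeq (fun n => (z n : ℂ)) ∧
      StronglyCorrelated x fun n => (z n : ℂ) := by
  obtain ⟨c, hc, hev⟩ := exists_eventually_of_pos_liminf (fun n => norm_nonneg _) h
  obtain ⟨z, hz, hyz⟩ := hy.exists_norm_corr_le hx (half_pos hc)
  exact ⟨z, hz, (half_pos hc).trans_le (le_liminf_of_le
    (isBoundedUnder_norm_corr hx z).isCoboundedUnder_ge
    (hev.mono fun n hn => by linarith [hyz n]))⟩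

end Genericity

end SeqCorr

theorem theorem1p2_general (K : Finset ℂ) {x : ℕ → ℂ} {M : ℝ} (hx : ∀ n, ‖x n‖ ≤ M) :
    ((∃ y : ℕ → K, SeqCorr.IsStrictlyErgodicSeq (fun n => (y n : ℂ)) ∧
        SeqCorr.WeaklyCorrelated x (fun n => (y n : ℂ))) ↔
      (∃ y : ℕ → K, SeqCorr.IsGenericForErgodic y ∧
        SeqCorr.WeaklyCorrelated x (fun n => (y n : ℂ)))) ∧
    ((∃ y : ℕ → K, SeqCorr.IsStrictlyErgodicSeq (fun n => (y n : ℂ)) ∧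
        SeqCorr.StronglyCorrelated x (fun n => (y n : ℂ))) ↔
      (∃ y : ℕ → K, SeqCorr.IsGenericForErgodic y ∧
        SeqCorr.StronglyCorrelated x (fun n => (y n : ℂ)))) :=
  ⟨⟨fun ⟨y, hy, h⟩ => ⟨y, hy.isGenericForErgodic, h⟩,
      fun ⟨_, hy, h⟩ => hy.exists_weaklyCorrelated hx h⟩,
    ⟨fun ⟨y, hy, h⟩ => ⟨y, hy.isGenericForErgodic, h⟩,
      fun ⟨_, hy, h⟩ => hy.exists_stronglyCorrelated hx h⟩⟩

theorem theorem1p2 (K : Finset ℂ) (hK : ∀ z ∈ K, ‖z‖ ≤ 1) (x : ℕ → K) :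
    ((∃ y : ℕ → K, SeqCorr.IsStrictlyErgodicSeq (fun n => (y n : ℂ)) ∧
        SeqCorr.WeaklyCorrelated (fun n => (x n : ℂ)) (fun n => (y n : ℂ))) ↔
      (∃ y : ℕ → K, SeqCorr.IsGenericForErgodic y ∧
        SeqCorr.WeaklyCorrelated (fun n => (x n : ℂ)) (fun n => (y n : ℂ)))) ∧
    ((∃ y : ℕ → K, SeqCorr.IsStrictlyErgodicSeq (fun n => (y n : ℂ)) ∧
        SeqCorr.StronglyCorrelated (fun n => (x n : ℂ)) (fun n => (y n : ℂ))) ↔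
      (∃ y : ℕ → K, SeqCorr.IsGenericForErgodic y ∧
        SeqCorr.StronglyCorrelated (fun n => (x n : ℂ)) (fun n => (y n : ℂ)))) :=
  theorem1p2_general K fun n => hK _ (x n).2
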